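/- Let $K$ be a field, $S=K[x_1,x_2,x_3]$ with its standard grading, and let $\mathcal A$ be a generic central arrangement of $n>3$ distinct planes $\alpha_1=0,\dots,\alpha_n=0$ through the origin of $K^3$: any three (or fewer) of the linear forms $\alpha_j$ are linearly independent. Put $f=\prod_j\alpha_j$. Let $\Omega^1(\mathcal A)$ be the $S$-module of logarithmic $1$-forms, that is, of rational $1$-forms $\omega$ such that the coefficients of both $\omega$ and $d\omega$ lie in $\frac1f S$. Let $\Omega^1_0(\mathcal A)$ be the kernel of the contraction $\sum_i\omega_i\,dx_i\mapsto\sum_i x_i\omega_i$ with the Euler vector field on $\Omega^1(\mathcal A)$. Grade $\Omega_0^1(\mathcal A)$ by giving each $dx_i$ degree $1$ and a quotient $p/q$ of homogeneous polynomials degree $\deg p-\deg q$. Then $\operatorname{Ext}^1_S(\Omega_0^1(\mathcal A),S)$, with its induced grading, is an Artinian graded $S$-module with Hilbert series $$\sum_{d\in\mathbb Z}\dim_K\operatorname{Ext}^1_S(\Omega_0^1(\mathcal A),S)_d\,t^d=\frac{(n-3)t^{-1}+(1-n)+(n-1)t^{n-3}+(3-n)t^{n-2}}{(1-t)^3},$$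 and its length as an $S$-module is $\binom{n-1}{3}$. -/

import Mathlib

open MvPolynomial CategoryTheory CategoryTheory.Abelian

noncomputable section

namespace LogForms

universe u

/-! ### Rational functions and rational differential forms on affine space -/

/-- The coordinate ring `S = K[x₁, …, x_ℓ]` of `V = K^ℓ`. -/
abbrev Coord (K : Type u) [Field K] (ℓ : ℕ) : Type u := MvPolynomial (Fin ℓ) K

/-- The field of rational functions on `V = K^ℓ`. -/
abbrev RatFun (K : Type u) [Field K] (ℓ : ℕ) : Type u := FractionRing (Coord K ℓ)

/-- Rational differential 1-forms `∑ i, ω i • dx_i` on `V`, written in the basis `dx_i`. -/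
abbrev RatForm (K : Type u) [Field K] (ℓ : ℕ) : Type u := Fin ℓ → RatFun K ℓ

variable {K : Type u} [Field K] {ℓ : ℕ}

/-- A polynomial as a rational function. -/
abbrev toRat : Coord K ℓ →+* RatFun K ℓ := algebraMap (Coord K ℓ) (RatFun K ℓ)

/-- The partial derivative `∂/∂x_i` on rational functions: the derivation that extends
`MvPolynomial.pderiv i`. -/
def ratPderiv (i : Fin ℓ) : Derivation K (RatFun K ℓ) (RatFun K ℓ) :=
  haveI : Algebra.FormallyEtale (Coord K ℓ) (RatFun K ℓ) :=
    Algebra.FormallyEtale.of_isLocalization (nonZeroDivisors (Coord K ℓ))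
  ((LinearMap.liftBaseChange (RatFun K ℓ)
      (((Algebra.linearMap (Coord K ℓ) (RatFun K ℓ)).compDer
        (MvPolynomial.pderiv (R := K) i)).liftKaehlerDifferential)).comp
    (KaehlerDifferential.tensorKaehlerEquivOfFormallyEtale K (Coord K ℓ)
      (RatFun K ℓ)).symm.toLinearMap).compDer (KaehlerDifferential.D K (RatFun K ℓ))

theorem ratPderiv_toRat (i : Fin ℓ) (p : Coord K ℓ) :
    ratPderiv i (toRat p) = toRat (pderiv i p) := by
  have : Algebra.FormallyEtale (Coord K ℓ) (RatFun K ℓ) :=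
    Algebra.FormallyEtale.of_isLocalization (nonZeroDivisors (Coord K ℓ))
  simp [ratPderiv, KaehlerDifferential.tensorKaehlerEquivOfFormallyEtale_symm_D_algebraMap]

/-- The coefficient of `dx_i ∧ dx_j` in the exterior derivative `dω`. -/
def extDerivCoeff (ω : RatForm K ℓ) (i j : Fin ℓ) : RatFun K ℓ :=
  ratPderiv i (ω j) - ratPderiv j (ω i)

/-- The rational function `r` lies in `(1/f) S`. -/
def PoleBound (f : Coord K ℓ) (r : RatFun K ℓ) : Prop := ∃ p : Coord K ℓ, toRat p = toRat f * r

theorem PoleBound.zero (f : Coord K ℓ) : PoleBound f (0 : RatFun K ℓ) := ⟨0, by simp⟩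

theorem PoleBound.add {f : Coord K ℓ} {r s : RatFun K ℓ} (hr : PoleBound f r) (hs : PoleBound f s) :
    PoleBound f (r + s) := by
  obtain ⟨p, hp⟩ := hr
  obtain ⟨q, hq⟩ := hs
  exact ⟨p + q, by rw [map_add, hp, hq]; ring⟩

theorem PoleBound.mul {f : Coord K ℓ} {r : RatFun K ℓ} (c : Coord K ℓ) (hr : PoleBound f r) :
    PoleBound f (toRat c * r) := by
  obtain ⟨p, hp⟩ := hr
  exact ⟨c * p, by rw [map_mul, hp]; ring⟩

/-- Logarithmic 1-forms along the divisor `f = 0`: the rational 1-forms `ω` such that both `ω`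
and `dω` have poles bounded by `1/f`. -/
def logForms (f : Coord K ℓ) : Submodule (Coord K ℓ) (RatForm K ℓ) where
  carrier := {ω | (∀ i, PoleBound f (ω i)) ∧ ∀ i j, PoleBound f (extDerivCoeff ω i j)}
  zero_mem' := ⟨fun _ => PoleBound.zero f, fun i j => by
    simpa [extDerivCoeff] using PoleBound.zero f⟩
  add_mem' := by
    rintro ω η ⟨h1, h2⟩ ⟨h3, h4⟩
    refine ⟨fun i => (h1 i).add (h3 i), fun i j => ?_⟩
    have e : extDerivCoeff (ω + η) i j = extDerivCoeff ω i j + extDerivCoeff η i j := by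
      simp only [extDerivCoeff, Pi.add_apply, map_add]; ring
    rw [e]
    exact (h2 i j).add (h4 i j)
  smul_mem' := by
    rintro c ω ⟨h1, h2⟩
    refine ⟨fun i => ?_, fun i j => ?_⟩
    · simpa [Algebra.smul_def] using (h1 i).mul c
    · have e : extDerivCoeff (c • ω) i j = toRat c * extDerivCoeff ω i j
          + (toRat (pderiv i c) * ω j + toRat (-pderiv j c) * ω i) := by
        simp only [extDerivCoeff, Pi.smul_apply, Algebra.smul_def, Derivation.leibniz,
          Algebra.algebraMap_self, RingHom.id_apply, ratPderiv_toRat, map_neg]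
        ring
      rw [e]
      exact ((h2 i j).mul c).add (((h1 j).mul _).add ((h1 i).mul _))

/-- Contraction of a rational 1-form with the Euler vector field `∑ i, x_i ∂/∂x_i`. -/
def eulerContraction : RatForm K ℓ →ₗ[Coord K ℓ] RatFun K ℓ :=
  ∑ i, (X i : Coord K ℓ) • LinearMap.proj i

/-- Relative logarithmic 1-forms `Ω¹₀`: the kernel of contraction with the Euler vector field
on logarithmic 1-forms. -/
def relLogForms (f : Coord K ℓ) : Submodule (Coord K ℓ) (RatForm K ℓ) :=
  logForms f ⊓ LinearMap.ker eulerContraction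

/-! ### Gradings -/

/-- The homogeneous polynomials of degree `k`, for `k ∈ ℤ`; this is zero for `k < 0`. -/
def polyPiece (k : ℤ) : Submodule K (Coord K ℓ) where
  carrier := {p | ∀ m, coeff m p ≠ 0 → (m.degree : ℤ) = k}
  zero_mem' := by intro m hm; simp at hm
  add_mem' := by
    intro p q hp hq m hm
    by_cases h : coeff m p = 0
    · exact hq m (by simpa [h] using hm)
    · exact hp m h
  smul_mem' := by
    intro c p hp m hm
    refine hp m ?_
    intro h
    simp [h] at hm

theorem mem_polyPiece_natCast (k : ℕ) (p : Coord K ℓ) :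
    p ∈ polyPiece (K := K) (ℓ := ℓ) (k : ℤ) ↔ p.IsHomogeneous k := by
  constructor
  · intro h m hm
    have := h m hm
    rw [Finsupp.degree_eq_weight_one] at this
    exact_mod_cast this
  · intro h m hm
    have := h hm
    rw [Finsupp.degree_eq_weight_one]
    exact_mod_cast this

/-- For `f` homogeneous of degree `n`, the relative logarithmic 1-forms of degree `d`, where
`dx_i` has degree 1: those `ω = η / f` with all coefficients of `η` homogeneous of
degree `d - 1 + n`. -/
def relLogFormsPiece (f : Coord K ℓ) (n : ℕ) (d : ℤ) : Submodule K (relLogForms f) where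
  carrier := {ω | ∀ i, ∃ p ∈ polyPiece (K := K) (ℓ := ℓ) (d - 1 + n),
    toRat p = toRat f * (ω : RatForm K ℓ) i}
  zero_mem' := fun i => ⟨0, Submodule.zero_mem _, by simp⟩
  add_mem' := by
    intro ω η hω hη i
    obtain ⟨p, hp, hp'⟩ := hω i
    obtain ⟨q, hq, hq'⟩ := hη i
    exact ⟨p + q, Submodule.add_mem _ hp hq, by
      rw [map_add, hp', hq', Submodule.coe_add, Pi.add_apply, mul_add]⟩
  smul_mem' := by
    intro c ω hω i
    obtain ⟨p, hp, hp'⟩ := hω i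
    refine ⟨c • p, Submodule.smul_mem _ c hp, ?_⟩
    have e : ((c • ω : relLogForms f) : RatForm K ℓ) i = c • (ω : RatForm K ℓ) i := rfl
    rw [e, mul_smul_comm, ← hp', Algebra.smul_def, map_mul,
      ← IsScalarTower.algebraMap_apply K (Coord K ℓ) (RatFun K ℓ), ← Algebra.smul_def]

/-! ### The graded module `Ext¹_S(M, S)` -/

section Ext

variable {M : Type u} [AddCommGroup M] [Module (Coord K ℓ) M] [Module K M]

/-- `Ext¹_S(M, S)`. -/
abbrev ExtOne (M : Type u) [AddCommGroup M] [Module (Coord K ℓ) M] : Type u :=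
  Ext (ModuleCat.of (Coord K ℓ) M) (ModuleCat.of (Coord K ℓ) (Coord K ℓ)) 1

/-- A presentation of the graded module `M = ⨁ d, ℳ d` by a finite graded free module
`⨁ i, S(-deg i)`: the basis vector `e_i` has degree `deg i` and is sent into `ℳ (deg i)`. -/
structure GradedPresentation (ℳ : ℤ → Submodule K M) where
  rank : ℕ
  deg : Fin rank → ℤ
  map : (Fin rank → Coord K ℓ) →ₗ[Coord K ℓ] M
  map_surjective : Function.Surjective map
  map_single_mem : ∀ i, map (Pi.single i 1) ∈ ℳ (deg i)

namespace GradedPresentation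

variable {ℳ : ℤ → Submodule K M} (P : GradedPresentation (ℓ := ℓ) ℳ)

/-- The linear form `φ : ker → S` on the module of relations is homogeneous of degree `d`: it
sends relations of degree `m` to polynomials of degree `m + d`. -/
def IsHomogeneousHom (d : ℤ) (φ : LinearMap.ker P.map →ₗ[Coord K ℓ] Coord K ℓ) : Prop :=
  ∀ (m : ℤ) (v : LinearMap.ker P.map),
    (∀ i, (v : Fin P.rank → Coord K ℓ) i ∈ polyPiece (K := K) (ℓ := ℓ) (m - P.deg i)) →
      φ v ∈ polyPiece (K := K) (ℓ := ℓ) (m + d)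

/-- The connecting map `Hom_S(ker, S) → Ext¹_S(M, S)` of `0 → ker → S^rank → M → 0`. -/
def connecting (φ : LinearMap.ker P.map →ₗ[Coord K ℓ] Coord K ℓ) : ExtOne (ℓ := ℓ) (K := K) M :=
  (LinearMap.shortExact_shortComplexKer P.map_surjective).extClass.comp
    (Ext.mk₀ (ModuleCat.ofHom φ)) (add_zero 1)

end GradedPresentation

/-- The degree `d` part of `Ext¹_S(M, S)`, for a finitely generated graded module
`M = ⨁ d, ℳ d`: the classes that come from a homogeneous linear form of degree `d` on the
module of relations of a finite graded free presentation of `M`. (All presentations give the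
same classes, and these already form a subspace.) -/
def extOnePiece (ℳ : ℤ → Submodule K M) (d : ℤ) : Submodule K (ExtOne (ℓ := ℓ) (K := K) M) :=
  Submodule.span K {e | ∃ (P : GradedPresentation (ℓ := ℓ) ℳ)
    (φ : LinearMap.ker P.map →ₗ[Coord K ℓ] Coord K ℓ), P.IsHomogeneousHom d φ ∧
      P.connecting φ = e}

end Ext

/-- The family `𝒩` of subspaces is a grading of the `S`-module `N`. -/
structure IsModuleGrading {N : Type u} [AddCommGroup N] [Module (Coord K ℓ) N] [Module K N]
    (𝒩 : ℤ → Submodule K N) : Prop where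
  isInternal : DirectSum.IsInternal 𝒩
  smul_mem : ∀ (i d : ℤ) (p : Coord K ℓ) (x : N),
    p ∈ polyPiece (K := K) (ℓ := ℓ) i → x ∈ 𝒩 d → p • x ∈ 𝒩 (i + d)

/-- All pieces `𝒩 d` are finite-dimensional, and `h = ∑ d, (dim_K 𝒩 d) t^d`. -/
def HasHilbertSeries {N : Type u} [AddCommGroup N] [Module K N] (𝒩 : ℤ → Submodule K N)
    (h : LaurentSeries ℚ) : Prop :=
  ∀ d : ℤ, FiniteDimensional K (𝒩 d) ∧ h.coeff d = (Module.finrank K (𝒩 d) : ℚ)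

/-- The variable `t` of the Laurent series field `ℚ((t))`. -/
def tVar : LaurentSeries ℚ := HahnSeries.single (1 : ℤ) (1 : ℚ)

/-! ### Arrangements -/

/-- The linear form with coefficient vector `a`. -/
def linForm (a : Fin ℓ → K) : Coord K ℓ := ∑ i, C (a i) * X i

/-- The defining polynomial of the central arrangement with hyperplanes `linForm (α j) = 0`. -/
def defPoly {n : ℕ} (α : Fin n → Fin ℓ → K) : Coord K ℓ := ∏ j, linForm (α j)

/-- The vectors `α j` are the coefficients of defining linear forms of `n` distinct hyperplanes
through the origin of `K^ℓ`, which form a generic arrangement of rank `ℓ`. -/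
structure IsGenericArrangement {n : ℕ} (α : Fin n → Fin ℓ → K) : Prop where
  ne_zero : ∀ j, α j ≠ 0
  distinct : ∀ i j, i ≠ j → LinearIndependent K ![α i, α j]
  rank_eq : Submodule.span K (Set.range α) = ⊤
  generic : ∀ s : Finset (Fin n), s.card ≤ ℓ → LinearIndependent K (fun j : s => α j)

/-- The module `Ω¹₀(A)` of an arrangement. -/
abbrev arrForms {n : ℕ} (α : Fin n → Fin ℓ → K) : Type u := relLogForms (defPoly α)

/-- The grading of `Ω¹₀(A)`. -/
abbrev arrFormsPiece {n : ℕ} (α : Fin n → Fin ℓ → K) (d : ℤ) : Submodule K (arrForms α) :=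
  relLogFormsPiece (defPoly α) n d

end LogForms

end

noncomputable section

namespace LogForms

universe u

/-! ### Linear forms of a generic arrangement and numerators of logarithmic forms -/

section

variable {K : Type u} [Field K]

/-! Write `n = N + 3`. The forms `dα_j/α_j` generate `Ω¹` (`TripleIndep.exists_eq_sum_dlog`). Indeed
a numerator `η` is congruent to `g_j dα_j` modulo `α_j`. Comparing two planes shows `g_j ∈ (α_j,
α_k)` for every `k ≠ j`, so genericity makes `g_j` a multiple of `∏_{k≠j} α_k` modulo `α_j`. Each
`dα_j/α_j` contracts to `1` with the Euler field, so the `N + 2` differences `dα_j/α_j - dα_0/α_0`,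
all of degree 0, generate `Ω¹₀`.

A relation `∑ c_j dα_j/α_j = 0` forces `c_j = α_j b_j` with `∑ b_j α_j = 0` as vectors, and such `b`
are polynomial combinations of the `N` constant relations (`TripleIndep.sum_smul_dlog_eq_zero_iff`,
`IsRelationBasis.eq_sum`). Hence there is a resolution `0 → S(-1)^N → S^(N+2) → Ω¹₀ → 0`, and `Ext¹`
is the cokernel of the transpose `S^(N+2) → S(1)^N`.

The transpose is injective in degrees below `N` (`IsRelationBasis.corelationMap_eq_zero`). A kernel
element is a derivation tangent to all planes, of degree at most `N`. Its cross product with the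
Euler field satisfies the congruences of a logarithmic numerator but has degree below `n - 1`, so it
vanishes. The derivation is thus a multiple of the Euler field, and the normalization of the kernel
element makes the multiple zero.

Counting dimensions, the piece of degree `k - 1` has dimension `N·C(k+2,2) - (N+2)·C(k+1,2) =
(k+1)(N-k)` for `0 ≤ k ≤ N`. It is zero at `k = N`, hence in all higher degrees, because the
cokernel is generated in degree `-1`. Summing over `k < N` gives the Hilbert series and the length.
-/

theorem linForm_add {ℓ : ℕ} (a b : Fin ℓ → K) : linForm (a + b) = linForm a + linForm b := by
  simp [linForm, add_mul, Finset.sum_add_distrib]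

theorem linForm_smul {ℓ : ℕ} (c : K) (a : Fin ℓ → K) : linForm (c • a) = C c * linForm a := by
  simp [linForm, Finset.mul_sum, mul_assoc]

theorem linForm_single {ℓ : ℕ} (i : Fin ℓ) : linForm (Pi.single i (1 : K)) = X i := by
  rw [linForm, Finset.sum_eq_single i] <;> simp +contextual

theorem linForm_isHomogeneous {ℓ : ℕ} (a : Fin ℓ → K) : (linForm a).IsHomogeneous 1 :=
  IsHomogeneous.sum _ _ _ fun i _ => by
    simpa using (isHomogeneous_C (Fin ℓ) (a i)).mul (isHomogeneous_X K i)

theorem pderiv_linForm {ℓ : ℕ} (a : Fin ℓ → K) (i : Fin ℓ) : pderiv i (linForm a) = C (a i) := by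
  simp [linForm, pderiv_X, Pi.single_apply]

theorem coeff_single_linForm {ℓ : ℕ} (a : Fin ℓ → K) (i : Fin ℓ) :
    coeff (Finsupp.single i 1) (linForm a) = a i := by
  rw [linForm, coeff_sum, Finset.sum_eq_single i]
  · simp
  · intro j _ hj
    rw [coeff_C_mul, coeff_X, if_neg, mul_zero]
    intro h
    exact hj ((Finsupp.single_left_inj one_ne_zero).1 h)
  · simp

theorem linForm_ne_zero {ℓ : ℕ} {a : Fin ℓ → K} (ha : a ≠ 0) : linForm a ≠ 0 := by
  intro h
  apply ha
  funext i
  rw [← coeff_single_linForm a i, h]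
  simp

theorem prime_linForm {ℓ : ℕ} {a : Fin ℓ → K} (ha : a ≠ 0) : Prime (linForm a) := by
  refine Irreducible.prime (irreducible_of_totalDegree_eq_one
    ((linForm_isHomogeneous a).totalDegree (linForm_ne_zero ha)) fun x hx => ?_)
  obtain ⟨i, hi⟩ := Function.ne_iff.1 ha
  have h := hx (Finsupp.single i 1)
  rw [coeff_single_linForm] at h
  exact isUnit_of_dvd_unit h (isUnit_iff_ne_zero.2 hi)

/-- Any three linear forms with distinct indices are linearly independent. -/
def TripleIndep {n : ℕ} (α : Fin n → Fin 3 → K) : Prop :=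
  ∀ j k l, j ≠ k → j ≠ l → k ≠ l → LinearIndependent K ![α j, α k, α l]

/-- A linearly independent triple of covectors has a dual basis. -/
theorem exists_dual_basis {a b c : Fin 3 → K} (h : LinearIndependent K ![a, b, c]) :
    ∃ u v w : Fin 3 → K, ∀ e : Fin 3 → K, e = (e ⬝ᵥ u) • a + (e ⬝ᵥ v) • b + (e ⬝ᵥ w) • c := by
  set M : Matrix (Fin 3) (Fin 3) K := Matrix.of ![a, b, c]
  have hM : IsUnit M := Matrix.linearIndependent_rows_iff_isUnit.1 h
  have hdet : IsUnit M.det := (Matrix.isUnit_iff_isUnit_det M).1 hM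
  -- The dual basis consists of the columns of the inverse of the matrix with rows `a, b, c`.
  refine ⟨fun i => M⁻¹ i 0, fun i => M⁻¹ i 1, fun i => M⁻¹ i 2, fun e => ?_⟩
  have h1 : Matrix.vecMul (Matrix.vecMul e M⁻¹) M = e := by
    rw [Matrix.vecMul_vecMul, Matrix.nonsing_inv_mul _ hdet, Matrix.vecMul_one]
  funext i
  conv_lhs => rw [← h1]
  simp [Matrix.vecMul, dotProduct, Fin.sum_univ_three, M]

theorem dual_basis_apply_all {a b c u v w : Fin 3 → K} (h : LinearIndependent K ![a, b, c])
    (H : ∀ e : Fin 3 → K, e = (e ⬝ᵥ u) • a + (e ⬝ᵥ v) • b + (e ⬝ᵥ w) • c) :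
    (a ⬝ᵥ u = 1 ∧ a ⬝ᵥ v = 0 ∧ a ⬝ᵥ w = 0) ∧ (b ⬝ᵥ u = 0 ∧ b ⬝ᵥ v = 1 ∧ b ⬝ᵥ w = 0) ∧
      (c ⬝ᵥ u = 0 ∧ c ⬝ᵥ v = 0 ∧ c ⬝ᵥ w = 1) := by
  rw [Fintype.linearIndependent_iff] at h
  have key : ∀ x y z : K, x • a + y • b + z • c = 0 → x = 0 ∧ y = 0 ∧ z = 0 := fun x y z hz =>
    have := h ![x, y, z] (by simpa [Fin.sum_univ_three] using hz)
    ⟨this 0, this 1, this 2⟩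
  have ha := key (a ⬝ᵥ u - 1) (a ⬝ᵥ v) (a ⬝ᵥ w)
    (by rw [sub_smul, one_smul]; linear_combination (exp := 1) -H a)
  have hb := key (b ⬝ᵥ u) (b ⬝ᵥ v - 1) (b ⬝ᵥ w)
    (by rw [sub_smul, one_smul]; linear_combination (exp := 1) -H b)
  have hc := key (c ⬝ᵥ u) (c ⬝ᵥ v) (c ⬝ᵥ w - 1)
    (by rw [sub_smul, one_smul]; linear_combination (exp := 1) -H c)
  simp only [sub_eq_zero] at ha hb hc
  exact ⟨ha, hb, hc⟩

theorem dual_basis_apply {a b c u v w : Fin 3 → K} (h : LinearIndependent K ![a, b, c])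
    (H : ∀ e : Fin 3 → K, e = (e ⬝ᵥ u) • a + (e ⬝ᵥ v) • b + (e ⬝ᵥ w) • c) :
    a ⬝ᵥ w = 0 ∧ b ⬝ᵥ w = 0 ∧ c ⬝ᵥ w = 1 :=
  have := dual_basis_apply_all h H
  ⟨this.1.2.2, this.2.1.2.2, this.2.2.2.2⟩

/-- If an algebra map sends every variable into a class mod `I`, it acts trivially mod `I`. -/
theorem sub_algHom_mem {σ : Type*} (I : Ideal (MvPolynomial σ K))
    (φ : MvPolynomial σ K →ₐ[K] MvPolynomial σ K) (h : ∀ i, X i - φ (X i) ∈ I)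
    (p : MvPolynomial σ K) : p - φ p ∈ I := by
  have e : Ideal.Quotient.mkₐ K I = (Ideal.Quotient.mkₐ K I).comp φ := by
    ext i
    simpa using (Ideal.Quotient.mk_eq_mk_iff_sub_mem _ _).2 (h i)
  exact (Ideal.Quotient.mk_eq_mk_iff_sub_mem _ _).1 (DFunLike.congr_fun e p)

/-- Independent linear forms: the last is a nonzerodivisor modulo the first two. -/
theorem mem_span_pair_of_mul_mem {a b c : Fin 3 → K} (h : LinearIndependent K ![a, b, c])
    {p : Coord K 3} (hp : linForm c * p ∈ Ideal.span {linForm a, linForm b}) :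
    p ∈ Ideal.span {linForm a, linForm b} := by
  obtain ⟨u, v, w, H⟩ := exists_dual_basis h
  obtain ⟨ha, hb, hc⟩ := dual_basis_apply h H
  -- `φ` restricts to the line spanned by `w`, where `a` and `b` vanish; `σ` sends the parameter
  -- back to `linForm c`. Since `σ ∘ φ` is the identity modulo `(a, b)`, the kernel of `φ` lies in
  -- that ideal, while `linForm c` restricts to the parameter, a nonzerodivisor.
  let φ : Coord K 3 →ₐ[K] Polynomial K := aeval fun i => Polynomial.C (w i) * Polynomial.X
  let σ : Polynomial K →ₐ[K] Coord K 3 := Polynomial.aeval (linForm c)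
  have hφ : ∀ e : Fin 3 → K, φ (linForm e) = Polynomial.C (e ⬝ᵥ w) * Polynomial.X := by
    intro e
    simp [φ, linForm, dotProduct, Finset.sum_mul, mul_assoc]
  have hle : Ideal.span {linForm a, linForm b} ≤ RingHom.ker φ := by
    rw [Ideal.span_le]
    rintro _ (rfl | rfl)
    · simp [hφ, ha]
    · simp [hφ, hb]
  have h0 : φ p = 0 := by
    have := hle hp
    rw [RingHom.mem_ker, map_mul, hφ, hc] at this
    simpa using this
  have := sub_algHom_mem (Ideal.span {linForm a, linForm b}) (σ.comp φ) (fun i => ?_) p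
  · simpa [h0] using this
  · have e1 : linForm (Pi.single i (1 : K)) = X i := linForm_single i
    have e2 := congrArg linForm (H (Pi.single i 1))
    rw [linForm_add, linForm_add, linForm_smul, linForm_smul, linForm_smul, e1] at e2
    have e3 : (σ.comp φ) (X i) = C (w i) * linForm c := by
      simp [σ, φ, MvPolynomial.algebraMap_eq]
    rw [e3, e2, Ideal.mem_span_pair]
    refine ⟨C (Pi.single i 1 ⬝ᵥ u), C (Pi.single i 1 ⬝ᵥ v), ?_⟩
    simp

theorem TripleIndep.ne_zero {n : ℕ} {α : Fin n → Fin 3 → K} (h : TripleIndep α) (hn : 3 ≤ n)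
    (j : Fin n) : α j ≠ 0 := by
  obtain ⟨k, hk, -⟩ := Fin.exists_ne_and_ne_of_two_lt j j hn
  obtain ⟨l, hl, hl'⟩ := Fin.exists_ne_and_ne_of_two_lt j k hn
  exact (h j k l hk.symm hl.symm hl'.symm).ne_zero 0

/-- A dual vector gives a point where `α j` vanishes and `α k` takes the value `1`. -/
theorem TripleIndep.not_dvd {n : ℕ} {α : Fin n → Fin 3 → K} (h : TripleIndep α) (hn : 3 ≤ n)
    {j k : Fin n} (hjk : j ≠ k) : ¬ linForm (α j) ∣ linForm (α k) := by
  obtain ⟨l, hl, hl'⟩ := Fin.exists_ne_and_ne_of_two_lt j k hn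
  have hi := h l j k hl hl' hjk
  obtain ⟨u, v, w, H⟩ := exists_dual_basis hi
  obtain ⟨-, hb, hc⟩ := dual_basis_apply hi H
  have hev : ∀ e : Fin 3 → K, eval w (linForm e) = e ⬝ᵥ w := by
    intro e
    simp [linForm, dotProduct]
  intro hd
  have := map_dvd (eval w) hd
  rw [hev, hev, hb, hc] at this
  simp at this

/-- The product of the defining forms other than the `j`-th one. -/
def coPoly {n : ℕ} (α : Fin n → Fin 3 → K) (j : Fin n) : Coord K 3 :=
  ∏ k ∈ Finset.univ.erase j, linForm (α k)

theorem linForm_mul_coPoly {n : ℕ} (α : Fin n → Fin 3 → K) (j : Fin n) :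
    linForm (α j) * coPoly α j = defPoly α :=
  Finset.mul_prod_erase _ (fun j => linForm (α j)) (Finset.mem_univ j)

theorem TripleIndep.not_dvd_coPoly {n : ℕ} {α : Fin n → Fin 3 → K} (h : TripleIndep α)
    (hn : 3 ≤ n) (j : Fin n) : ¬ linForm (α j) ∣ coPoly α j := by
  intro hd
  obtain ⟨k, hk, hk'⟩ := (prime_linForm (h.ne_zero hn j)).exists_mem_finset_dvd hd
  exact h.not_dvd hn (Finset.ne_of_mem_erase hk).symm hk'

theorem dvd_coPoly {n : ℕ} (α : Fin n → Fin 3 → K) {j k : Fin n} (hjk : j ≠ k) :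
    linForm (α j) ∣ coPoly α k :=
  Finset.dvd_prod_of_mem (fun k => linForm (α k))
    (Finset.mem_erase.2 ⟨hjk, Finset.mem_univ j⟩)

theorem TripleIndep.defPoly_ne_zero {n : ℕ} {α : Fin n → Fin 3 → K} (h : TripleIndep α)
    (hn : 3 ≤ n) : defPoly α ≠ 0 :=
  Finset.prod_ne_zero_iff.2 fun j _ => linForm_ne_zero (h.ne_zero hn j)

theorem TripleIndep.defPoly_dvd {n : ℕ} {α : Fin n → Fin 3 → K} (h : TripleIndep α)
    (hn : 3 ≤ n) {p : Coord K 3} (hp : ∀ j, linForm (α j) ∣ p) : defPoly α ∣ p := by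
  refine Finset.prod_dvd_of_isRelPrime (fun j _ k _ hjk => ?_) fun j _ => hp j
  exact (prime_linForm (h.ne_zero hn j)).irreducible.isRelPrime_iff_not_dvd.2
    (h.not_dvd hn hjk)

/-- A polynomial that lies in `(α j, α k)` for all `k ≠ j` is a multiple of
`∏ k ≠ j, α k` modulo `α j`. -/
theorem TripleIndep.exists_coPoly_mul {n : ℕ} {α : Fin n → Fin 3 → K} (h : TripleIndep α)
    (j : Fin n) {g : Coord K 3}
    (hg : ∀ k, k ≠ j → g ∈ Ideal.span {linForm (α j), linForm (α k)}) :
    ∃ c, linForm (α j) ∣ g - c * coPoly α j := by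
  suffices H : ∀ s : Finset (Fin n), j ∉ s →
      ∃ c, linForm (α j) ∣ g - c * ∏ k ∈ s, linForm (α k) from
    H _ (Finset.notMem_erase _ _)
  intro s
  induction s using Finset.induction_on with
  | empty => exact fun _ => ⟨g, by simp⟩
  | insert k s hk ih =>
    intro hj
    rw [Finset.mem_insert, not_or] at hj
    obtain ⟨c, d, hd⟩ := ih hj.2
    have hmem : (∏ l ∈ s, linForm (α l)) * c ∈ Ideal.span {linForm (α j), linForm (α k)} := by
      have e : (∏ l ∈ s, linForm (α l)) * c = g - linForm (α j) * d := by rw [← hd]; ring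
      rw [e]
      exact sub_mem (hg k (Ne.symm hj.1))
        (Ideal.mul_mem_right _ _ (Ideal.subset_span (by simp)))
    -- The factors `α l` are cancelled one at a time, each being a nonzerodivisor modulo `(α j, α
    -- k)`.
    have hc : ∀ t ⊆ s, (∏ l ∈ t, linForm (α l)) * c ∈
        Ideal.span {linForm (α j), linForm (α k)} →
          c ∈ Ideal.span {linForm (α j), linForm (α k)} := by
      intro t
      induction t using Finset.induction_on with
      | empty => simp
      | insert l t hl iht =>
        intro hts hm
        rw [Finset.prod_insert hl, mul_assoc] at hm
        have hls : l ∈ s := hts (Finset.mem_insert_self _ _)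
        refine iht (fun x hx => hts (Finset.mem_insert_of_mem hx)) (mem_span_pair_of_mul_mem
          (h j k l hj.1 ?_ ?_) hm)
        · rintro rfl; exact hj.2 hls
        · rintro rfl; exact hk hls
    obtain ⟨x, y, hxy⟩ := Ideal.mem_span_pair.1 (hc s subset_rfl hmem)
    refine ⟨y, d + x * ∏ l ∈ s, linForm (α l), ?_⟩
    rw [Finset.prod_insert hk]
    linear_combination hd - (∏ l ∈ s, linForm (α l)) * hxy

/-- If `g dα_j` and `g' dα_k` agree modulo `(α_j, α_k)`, pairing with a vector `w` such that `α_j(w)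
= 1` and `α_k(w) = 0` isolates `g`. -/
theorem TripleIndep.mem_span_pair {n : ℕ} {α : Fin n → Fin 3 → K} (h : TripleIndep α)
    (hn : 3 ≤ n) {j k : Fin n} (hjk : j ≠ k) {g g' : Coord K 3}
    (H : ∀ i, C (α j i) * g - C (α k i) * g' ∈ Ideal.span {linForm (α j), linForm (α k)}) :
    g ∈ Ideal.span {linForm (α j), linForm (α k)} := by
  obtain ⟨l, hl, hl'⟩ := Fin.exists_ne_and_ne_of_two_lt j k hn
  have hi := h l k j hl' hl hjk.symm
  obtain ⟨u, v, w, D⟩ := exists_dual_basis hi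
  obtain ⟨-, hb, hc⟩ := dual_basis_apply hi D
  have e : g = ∑ i, C (w i) * (C (α j i) * g - C (α k i) * g') := by
    have e1 : ∑ i, C (w i) * (C (α j i) * g - C (α k i) * g')
        = C (α j ⬝ᵥ w) * g - C (α k ⬝ᵥ w) * g' := by
      simp only [dotProduct, map_sum, map_mul, Finset.sum_mul, ← Finset.sum_sub_distrib]
      exact Finset.sum_congr rfl fun i _ => by ring
    rw [e1, hb, hc]; simp
  rw [e]
  exact Ideal.sum_mem _ fun i _ => Ideal.mul_mem_left _ _ (H i)

/-- Vectors of polynomials are polynomial combinations of a basis of `K^3`. -/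
theorem exists_eq_combination {a b c : Fin 3 → K} (h : LinearIndependent K ![a, b, c])
    (θ : Fin 3 → Coord K 3) :
    ∃ τ υ φ : Coord K 3, ∀ i, θ i = τ * C (a i) + υ * C (b i) + φ * C (c i) := by
  obtain ⟨u, v, w, H⟩ := exists_dual_basis h
  refine ⟨∑ i, θ i * C (u i), ∑ i, θ i * C (v i), ∑ i, θ i * C (w i), fun i => ?_⟩
  have e : ∀ i', θ i' * C (u i') * C (a i) + θ i' * C (v i') * C (b i) + θ i' * C (w i') * C (c i)
      = θ i' * C (Pi.single (M := fun _ => K) i' 1 i) := by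
    intro i'
    conv_rhs => rw [H (Pi.single i' 1)]
    simp only [single_one_dotProduct, Pi.add_apply, Pi.smul_apply, smul_eq_mul, map_add, map_mul]
    ring
  simp only [Finset.sum_mul, ← Finset.sum_add_distrib, e]
  rw [Finset.sum_eq_single i] <;> simp +contextual [eq_comm]

/-- Polynomial 1-forms `η` with `dα j ∧ η ∈ (α j)` for all `j` are combinations of the forms
`(∏ k ≠ j, α k) dα j`. -/
theorem TripleIndep.exists_eq_sum {n : ℕ} {α : Fin n → Fin 3 → K} (h : TripleIndep α)
    (hn : 3 ≤ n) {η : Fin 3 → Coord K 3}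
    (hη : ∀ j i i', linForm (α j) ∣ C (α j i) * η i' - C (α j i') * η i) :
    ∃ c : Fin n → Coord K 3, ∀ i, η i = ∑ j, c j * (coPoly α j * C (α j i)) := by
  have h1 : ∀ j, ∃ g, ∀ i, linForm (α j) ∣ η i - C (α j i) * g := by
    intro j
    obtain ⟨i₀, hi₀⟩ := Function.ne_iff.1 (h.ne_zero hn j)
    -- Modulo `α j` the form `η` is parallel to `dα j`; the factor is read off at a nonzero
    -- coordinate of `α j`.
    refine ⟨C (α j i₀)⁻¹ * η i₀, fun i => ?_⟩
    have := (hη j i₀ i).mul_left (C (α j i₀)⁻¹)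
    convert this using 1
    have e : (C (α j i₀)⁻¹ * C (α j i₀) : Coord K 3) = 1 := by
      rw [← C_mul, inv_mul_cancel₀ hi₀, C_1]
    linear_combination - η i * e
  choose g hg using h1
  have h2 : ∀ j, ∃ c, linForm (α j) ∣ g j - c * coPoly α j := by
    intro j
    refine h.exists_coPoly_mul j fun k hk => h.mem_span_pair hn hk.symm (g' := g k) fun i => ?_
    obtain ⟨x, hx⟩ := hg j i
    obtain ⟨y, hy⟩ := hg k i
    rw [Ideal.mem_span_pair]
    exact ⟨-x, y, by linear_combination hx - hy⟩
  choose c hc using h2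
  have h3 : ∀ i, defPoly α ∣ η i - ∑ j, c j * (coPoly α j * C (α j i)) := by
    intro i
    refine h.defPoly_dvd hn fun j => ?_
    rw [← Finset.add_sum_erase _ _ (Finset.mem_univ j), ← sub_sub]
    refine dvd_sub ?_ (Finset.dvd_sum fun k hk => ?_)
    · have := (hg j i).add ((hc j).mul_left (C (α j i)))
      convert this using 1
      ring
    · exact ((dvd_coPoly α (Finset.ne_of_mem_erase hk).symm).mul_right _).mul_left _
  choose θ hθ using h3
  obtain ⟨k, hk, -⟩ := Fin.exists_ne_and_ne_of_two_lt ⟨0, by omega⟩ ⟨0, by omega⟩ hn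
  obtain ⟨l, hl, hl'⟩ := Fin.exists_ne_and_ne_of_two_lt ⟨0, by omega⟩ k hn
  obtain ⟨τ, υ, φ, H⟩ := exists_eq_combination (h _ k l hk.symm hl.symm hl'.symm) θ
  -- The remainder is `f θ`. Expanding `θ` in three of the vectors `α j` and writing `f = α j ·
  -- coPoly α j` absorbs it into three of the coefficients.
  refine ⟨c + Pi.single ⟨0, by omega⟩ (τ * linForm (α ⟨0, by omega⟩)) +
    Pi.single k (υ * linForm (α k)) + Pi.single l (φ * linForm (α l)), fun i => ?_⟩
  have e := hθ i
  rw [H i, mul_add, mul_add, sub_eq_iff_eq_add] at e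
  simp only [Pi.add_apply, add_mul, Finset.sum_add_distrib]
  have hs : ∀ j x, ∑ j', (Pi.single j x : Fin n → Coord K 3) j' * (coPoly α j' * C (α j' i))
      = x * (coPoly α j * C (α j i)) := fun j x => by simp [Pi.single_apply]
  rw [hs, hs, hs, e]
  linear_combination (- τ * C (α ⟨0, by omega⟩ i)) * linForm_mul_coPoly α ⟨0, by omega⟩
    - υ * C (α k i) * linForm_mul_coPoly α k - φ * C (α l i) * linForm_mul_coPoly α l

end

/-! ### Generators of the logarithmic forms and relations among them -/

section

variable {K : Type u} [Field K]

theorem IsGenericArrangement.tripleIndep {n : ℕ} {α : Fin n → Fin 3 → K}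
    (h : IsGenericArrangement α) : TripleIndep α := by
  intro j k l hjk hjl hkl
  have hs := h.generic {j, k, l} (Finset.card_le_three)
  let e : Fin 3 → ({j, k, l} : Finset (Fin n)) :=
    ![⟨j, by simp⟩, ⟨k, by simp⟩, ⟨l, by simp⟩]
  have he : Function.Injective e := by
    intro a b hab
    fin_cases a <;> fin_cases b <;> simp_all [e]
  convert hs.comp e he using 1
  funext a
  fin_cases a <;> rfl

theorem toRat_injective {ℓ : ℕ} : Function.Injective (toRat : Coord K ℓ →+* RatFun K ℓ) :=
  IsFractionRing.injective _ _

theorem toRat_ne_zero {ℓ : ℕ} {p : Coord K ℓ} (hp : p ≠ 0) : toRat p ≠ 0 :=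
  (map_ne_zero_iff _ toRat_injective).2 hp

/-- The logarithmic form `dα / α`. -/
def dlog {ℓ : ℕ} (a : Fin ℓ → K) : RatForm K ℓ :=
  fun i => toRat (C (a i)) / toRat (linForm a)

/-- Differentiating `α · (dα/α)_j = α_j`, a constant, shows that `α · ∂_i (dα/α)_j` is symmetric in
`i` and `j`. -/
theorem extDerivCoeff_dlog {ℓ : ℕ} {a : Fin ℓ → K} (ha : a ≠ 0) (i j : Fin ℓ) :
    extDerivCoeff (dlog a) i j = 0 := by
  have h0 := toRat_ne_zero (linForm_ne_zero ha)
  have h : ∀ i j, toRat (linForm a) * ratPderiv i (dlog a j)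
      = - (dlog a j * toRat (C (a i))) := by
    intro i j
    have e : toRat (linForm a) * dlog a j = toRat (C (a j)) := mul_div_cancel₀ _ h0
    have e2 := congrArg (ratPderiv i) e
    rw [Derivation.leibniz, ratPderiv_toRat, ratPderiv_toRat, pderiv_C, map_zero,
      pderiv_linForm, smul_eq_mul, smul_eq_mul] at e2
    linear_combination e2
  have e : toRat (linForm a) * extDerivCoeff (dlog a) i j = 0 := by
    rw [extDerivCoeff, mul_sub, h, h]
    simp only [dlog]
    ring
  exact (mul_eq_zero.1 e).resolve_left h0

theorem eulerContraction_dlog {ℓ : ℕ} {a : Fin ℓ → K} (ha : a ≠ 0) :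
    eulerContraction (dlog a) = 1 := by
  have h0 := toRat_ne_zero (linForm_ne_zero ha)
  have : eulerContraction (dlog a) = ∑ i, toRat (C (a i) * X i) / toRat (linForm a) := by
    simp only [eulerContraction, LinearMap.sum_apply, LinearMap.smul_apply, LinearMap.proj_apply,
      dlog, Algebra.smul_def, map_mul]
    exact Finset.sum_congr rfl fun i _ => by ring
  rw [this, ← Finset.sum_div, ← map_sum, ← linForm, div_self h0]

theorem toRat_defPoly_mul_dlog {n : ℕ} {α : Fin n → Fin 3 → K} {j : Fin n} (h : α j ≠ 0)
    (i : Fin 3) : toRat (defPoly α) * dlog (α j) i = toRat (coPoly α j * C (α j i)) := by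
  have h0 := toRat_ne_zero (linForm_ne_zero h)
  rw [dlog, ← linForm_mul_coPoly α j, map_mul, map_mul]
  field_simp

theorem toRat_defPoly_mul_smul_dlog {n : ℕ} {α : Fin n → Fin 3 → K} {j : Fin n} (h : α j ≠ 0)
    (c : Coord K 3) (i : Fin 3) :
    toRat (defPoly α) * (c • dlog (α j)) i = toRat (c * (coPoly α j * C (α j i))) := by
  rw [Pi.smul_apply, Algebra.smul_def, map_mul, ← toRat_defPoly_mul_dlog h]
  ring

theorem dlog_mem_logForms {n : ℕ} {α : Fin n → Fin 3 → K} {j : Fin n} (h : α j ≠ 0) :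
    dlog (α j) ∈ logForms (defPoly α) :=
  ⟨fun i => ⟨_, (toRat_defPoly_mul_dlog h i).symm⟩, fun i i' => by
    rw [extDerivCoeff_dlog h]; exact PoleBound.zero _⟩

/-- The numerator `η = f ω` of a logarithmic form satisfies `f ∣ df ∧ η`. -/
theorem dvd_of_mem_logForms {ℓ : ℕ} {f : Coord K ℓ} {ω : RatForm K ℓ}
    (hω : ω ∈ logForms f) {η : Fin ℓ → Coord K ℓ} (hη : ∀ i, toRat (η i) = toRat f * ω i)
    (i j : Fin ℓ) : f ∣ pderiv i f * η j - pderiv j f * η i := by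
  obtain ⟨p, hp⟩ := hω.2 i j
  have h : ∀ i j, toRat f * ratPderiv i (ω j) + ω j * toRat (pderiv i f)
      = toRat (pderiv i (η j)) := by
    intro i j
    rw [← ratPderiv_toRat i (η j), hη, Derivation.leibniz, ratPderiv_toRat, smul_eq_mul,
      smul_eq_mul]
  -- From `η = f ω` follows `dη = df ∧ ω + f dω`; multiplying by `f` gives `df ∧ η = f (dη - f dω)`,
  -- and `p` is the coefficient of `f dω`.
  refine ⟨pderiv i (η j) - pderiv j (η i) - p, toRat_injective ?_⟩
  simp only [map_sub, map_mul, hη, hp, ← h, extDerivCoeff]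
  ring

/-- Modulo `α j` one has `df = coPoly α j · dα j`. As `α j` does not divide `coPoly α j`, the
divisibility `f ∣ df ∧ η` leaves `α j ∣ dα j ∧ η`, which is the hypothesis of
`TripleIndep.exists_eq_sum`. -/
theorem TripleIndep.exists_eq_sum_dlog {n : ℕ} {α : Fin n → Fin 3 → K} (h : TripleIndep α)
    (hn : 3 ≤ n) {ω : RatForm K 3} (hω : ω ∈ logForms (defPoly α)) :
    ∃ c : Fin n → Coord K 3, ω = ∑ j, c j • dlog (α j) := by
  choose η hη using hω.1
  have hd : ∀ j i i', linForm (α j) ∣ C (α j i) * η i' - C (α j i') * η i := by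
    intro j i i'
    have hp := prime_linForm (h.ne_zero hn j)
    have h1 : linForm (α j) ∣ coPoly α j * (C (α j i) * η i' - C (α j i') * η i) := by
      have h2 := (Dvd.intro _ (linForm_mul_coPoly α j)).trans (dvd_of_mem_logForms hω hη i i')
      have e : ∀ i, pderiv i (defPoly α) = linForm (α j) * pderiv i (coPoly α j)
          + coPoly α j * C (α j i) := by
        intro i
        rw [← linForm_mul_coPoly α j, Derivation.leibniz, pderiv_linForm, smul_eq_mul, smul_eq_mul]
      rw [e, e] at h2
      have h3 := h2.sub (Dvd.intro
        (pderiv i (coPoly α j) * η i' - pderiv i' (coPoly α j) * η i) rfl)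
      convert h3 using 1
      ring
    exact (hp.dvd_mul.1 h1).resolve_left (h.not_dvd_coPoly hn j)
  obtain ⟨c, hc⟩ := h.exists_eq_sum hn hd
  refine ⟨c, funext fun i => ?_⟩
  have h0 := toRat_ne_zero (h.defPoly_ne_zero hn)
  apply mul_left_cancel₀ h0
  rw [← hη, hc, map_sum, Finset.sum_apply, Finset.mul_sum]
  refine Finset.sum_congr rfl fun j _ => ?_
  rw [toRat_defPoly_mul_smul_dlog (h.ne_zero hn j)]

/-- The forms `dα_{i+1} / α_{i+1} - dα_0 / α_0`. -/
def relDlog {m : ℕ} (α : Fin (m + 1) → Fin 3 → K) (h : ∀ j, α j ≠ 0) (i : Fin m) : arrForms α :=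
  ⟨dlog (α i.succ) - dlog (α 0), sub_mem (dlog_mem_logForms (h _)) (dlog_mem_logForms (h _)), by
    change eulerContraction _ = 0
    rw [map_sub, eulerContraction_dlog (h _), eulerContraction_dlog (h _),
      sub_self]⟩

/-- The coefficient vector in `S^n`, of sum zero, that extends `c`. -/
def extendZero {R : Type*} [AddCommGroup R] {m : ℕ} (c : Fin m → R) : Fin (m + 1) → R :=
  Fin.cons (-∑ i, c i) c

theorem coe_linearCombination_relDlog {m : ℕ} (α : Fin (m + 1) → Fin 3 → K) (h : ∀ j, α j ≠ 0)
    (c : Fin m → Coord K 3) :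
    ((Fintype.linearCombination (Coord K 3) (relDlog α h) c : arrForms α) : RatForm K 3)
      = ∑ j, extendZero c j • dlog (α j) := by
  rw [Fintype.linearCombination_apply, Fin.sum_univ_succ, Submodule.coe_sum]
  simp only [extendZero, Fin.cons_zero, Fin.cons_succ, Submodule.coe_smul, relDlog, smul_sub,
    Finset.sum_sub_distrib, neg_smul, Finset.sum_smul]
  abel

theorem relDlog_surjective {m : ℕ} {α : Fin (m + 1) → Fin 3 → K} (h : TripleIndep α)
    (hm : 3 ≤ m + 1) : Function.Surjective
      (Fintype.linearCombination (Coord K 3) (relDlog α (h.ne_zero hm))) := by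
  rintro ⟨ω, hω, hω'⟩
  obtain ⟨c, rfl⟩ := h.exists_eq_sum_dlog hm hω
  refine ⟨fun i => c i.succ, Subtype.ext ?_⟩
  rw [coe_linearCombination_relDlog]
  have hc : ∑ j, c j = 0 := by
    change eulerContraction _ = 0 at hω'
    rw [map_sum] at hω'
    apply toRat_injective
    simp only [map_smul, eulerContraction_dlog (h.ne_zero hm _)] at hω'
    simpa [Algebra.smul_def] using hω'
  refine Finset.sum_congr rfl fun j _ => congrArg (· • dlog (α j)) ?_
  refine Fin.cases ?_ (fun i => ?_) j
  · rw [Fin.sum_univ_succ] at hc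
    exact (eq_neg_of_add_eq_zero_left hc).symm
  · simp [extendZero]

/-- Relations among the `dlog (α j)` are given by relations among the `α j`. -/
theorem TripleIndep.sum_smul_dlog_eq_zero_iff {n : ℕ} {α : Fin n → Fin 3 → K} (h : TripleIndep α)
    (hn : 3 ≤ n) (c : Fin n → Coord K 3) :
    ∑ j, c j • dlog (α j) = 0 ↔ ∃ b : Fin n → Coord K 3, (∀ j, c j = linForm (α j) * b j) ∧
      ∀ i, ∑ j, b j * C (α j i) = 0 := by
  constructor
  · intro hc
    have h1 : ∀ i, ∑ j, c j * (coPoly α j * C (α j i)) = 0 := by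
      intro i
      apply toRat_injective
      have := congrArg (fun ω : RatForm K 3 => toRat (defPoly α) * ω i) hc
      simpa only [Finset.sum_apply, Finset.mul_sum, toRat_defPoly_mul_smul_dlog (h.ne_zero hn _),
        Pi.zero_apply, mul_zero, map_sum, map_zero] using this
    have h2 : ∀ j, linForm (α j) ∣ c j := by
      intro j
      have hp := prime_linForm (h.ne_zero hn j)
      obtain ⟨i, hi⟩ := Function.ne_iff.1 (h.ne_zero hn j)
      -- Every other summand contains `α j` through its `coPoly`.
      have h3 : linForm (α j) ∣ c j * (coPoly α j * C (α j i)) := by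
        have := h1 i
        rw [← Finset.add_sum_erase _ _ (Finset.mem_univ j)] at this
        rw [eq_neg_of_add_eq_zero_left this]
        exact (Finset.dvd_sum fun k hk =>
          ((dvd_coPoly α (Finset.ne_of_mem_erase hk).symm).mul_right _).mul_left _).neg_right
      refine (hp.dvd_mul.1 h3).resolve_right fun h4 => ?_
      refine (hp.dvd_mul.1 h4).elim (h.not_dvd_coPoly hn j) fun h5 => hp.not_isUnit ?_
      exact isUnit_of_dvd_unit h5 ((isUnit_iff_ne_zero.2 hi).map C)
    choose b hb using h2
    refine ⟨b, hb, fun i => ?_⟩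
    have := h1 i
    apply mul_left_cancel₀ (h.defPoly_ne_zero hn)
    rw [mul_zero, ← this, Finset.mul_sum]
    refine Finset.sum_congr rfl fun j _ => ?_
    rw [hb j, ← linForm_mul_coPoly α j]
    ring
  · rintro ⟨b, hb, hb'⟩
    funext i
    rw [Finset.sum_apply, Pi.zero_apply, ← map_zero toRat, ← hb' i, map_sum]
    refine Finset.sum_congr rfl fun j _ => ?_
    have h0 := toRat_ne_zero (linForm_ne_zero (h.ne_zero hn j))
    rw [Pi.smul_apply, Algebra.smul_def, hb, dlog, map_mul, map_mul]
    field_simp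

end

section

variable {K : Type u} [Field K] {ℓ : ℕ}

/-! ### Homogeneous components indexed by integers -/

open Classical in
/-- The homogeneous component of degree `k ∈ ℤ`. -/
def polyComp (k : ℤ) : Coord K ℓ →ₗ[K] Coord K ℓ :=
  if 0 ≤ k then homogeneousComponent k.toNat else 0

theorem coeff_polyComp (k : ℤ) (p : Coord K ℓ) (m : Fin ℓ →₀ ℕ) :
    coeff m (polyComp k p) = if (m.degree : ℤ) = k then coeff m p else 0 := by
  classical
  by_cases hk : 0 ≤ k
  · rw [polyComp, if_pos hk, coeff_homogeneousComponent]
    congr 1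
    apply propext
    omega
  · rw [polyComp, if_neg hk, if_neg (by omega)]
    simp

theorem polyComp_mem (k : ℤ) (p : Coord K ℓ) : polyComp k p ∈ polyPiece (K := K) (ℓ := ℓ) k := by
  intro m hm
  rw [coeff_polyComp] at hm
  exact by_contra fun h => hm (if_neg h)

theorem polyComp_of_mem {k : ℤ} {p : Coord K ℓ} (hp : p ∈ polyPiece (K := K) (ℓ := ℓ) k) :
    polyComp k p = p := by
  ext m
  rw [coeff_polyComp]
  split_ifs with h
  · rfl
  · exact (by_contra fun h' => h (hp m fun h'' => h' h''.symm))

theorem polyComp_of_mem_of_ne {k l : ℤ} {p : Coord K ℓ} (hp : p ∈ polyPiece (K := K) (ℓ := ℓ) l)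
    (h : l ≠ k) : polyComp k p = 0 := by
  ext m
  rw [coeff_polyComp, coeff_zero]
  split_ifs with h1
  · exact by_contra fun h' => h ((hp m h').symm.trans h1)
  · rfl

/-- Taking components commutes with multiplication by a homogeneous factor. Solutions of homogeneous
linear equations can therefore be truncated to the expected degree. -/
theorem polyComp_mul {a b k : ℤ} (h : a + b = k) (p : Coord K ℓ) {q : Coord K ℓ}
    (hq : q ∈ polyPiece (K := K) (ℓ := ℓ) b) : polyComp k (p * q) = polyComp a p * q := by
  ext m
  rw [coeff_polyComp, coeff_mul, coeff_mul, ← Finset.sum_const_zero, ← Finset.sum_ite_irrel]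
  refine Finset.sum_congr rfl fun x hx => ?_
  rw [coeff_polyComp]
  by_cases h0 : coeff x.2 q = 0
  · simp [h0]
  · have h1 := hq _ h0
    have h2 : m.degree = x.1.degree + x.2.degree := by
      rw [← Finset.HasAntidiagonal.mem_antidiagonal.1 hx, map_add]
    have h3 : (m.degree : ℤ) = k ↔ (x.1.degree : ℤ) = a := by omega
    simp only [h3]
    split_ifs <;> simp

theorem mul_mem_polyPiece {a b k : ℤ} (h : a + b = k) {p q : Coord K ℓ}
    (hp : p ∈ polyPiece (K := K) (ℓ := ℓ) a) (hq : q ∈ polyPiece (K := K) (ℓ := ℓ) b) :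
    p * q ∈ polyPiece (K := K) (ℓ := ℓ) k := by
  have := polyComp_mul h p hq
  rw [polyComp_of_mem hp] at this
  rw [← this]
  exact polyComp_mem _ _

/-! ### The connecting map -/

section Ext

variable {M : Type u} [AddCommGroup M] [Module (Coord K ℓ) M]

theorem C_smul_extOne (c : K) (x : ExtOne (ℓ := ℓ) (K := K) M) :
    (C c : Coord K ℓ) • x = c • x := by
  rw [Ext.smul_eq_comp_mk₀, Ext.smul_eq_comp_mk₀]
  congr 2

instance : IsScalarTower K (Coord K ℓ) (ExtOne (ℓ := ℓ) (K := K) M) where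
  smul_assoc c p x := by
    rw [MvPolynomial.smul_eq_C_mul, mul_smul, C_smul_extOne]

variable [Module K M]

namespace GradedPresentation

variable {ℳ : ℤ → Submodule K M} (P : GradedPresentation (ℓ := ℓ) ℳ)

/-- The connecting map as a linear map. -/
def connectingₗ : (LinearMap.ker P.map →ₗ[Coord K ℓ] Coord K ℓ) →ₗ[Coord K ℓ]
    ExtOne (ℓ := ℓ) (K := K) M where
  toFun := P.connecting
  map_add' φ ψ := by
    simp [connecting, ModuleCat.ofHom_add, Ext.mk₀_add]
  map_smul' c φ := by
    have : ModuleCat.ofHom (c • φ) = c • ModuleCat.ofHom φ := rfl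
    simp [connecting, this, Ext.mk₀_smul]

/-- The middle term of the presentation is free, so its `Ext¹` vanishes in the long exact sequence.
-/
theorem connecting_surjective : Function.Surjective P.connecting := by
  intro e
  have : Projective (ModuleCat.of (Coord K ℓ) (Fin P.rank → Coord K ℓ)) :=
    ModuleCat.projective_of_free (Pi.basisFun (Coord K ℓ) (Fin P.rank))
  obtain ⟨x, hx⟩ := Ext.contravariant_sequence_exact₃
    (LinearMap.shortExact_shortComplexKer P.map_surjective) _ e (Ext.eq_zero_of_projective _)
    (add_zero 1)
  obtain ⟨f, rfl⟩ := Ext.homEquiv₀.symm.surjective x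
  exact ⟨f.hom, hx⟩

theorem connecting_eq_zero_iff (φ : LinearMap.ker P.map →ₗ[Coord K ℓ] Coord K ℓ) :
    P.connecting φ = 0 ↔ ∃ ψ : (Fin P.rank → Coord K ℓ) →ₗ[Coord K ℓ] Coord K ℓ,
      ∀ v : LinearMap.ker P.map, ψ v = φ v := by
  constructor
  · intro h
    obtain ⟨x, hx⟩ := Ext.contravariant_sequence_exact₁
      (LinearMap.shortExact_shortComplexKer P.map_surjective) _ _ _ h
    obtain ⟨f, rfl⟩ := Ext.homEquiv₀.symm.surjective x
    refine ⟨f.hom, fun v => ?_⟩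
    have h1 : Ext.mk₀ (P.map.shortComplexKer.f ≫ f) = Ext.mk₀ (ModuleCat.ofHom φ) := by
      rw [← Ext.mk₀_comp_mk₀]
      exact hx
    have h2 := Ext.homEquiv₀.symm.injective h1
    exact LinearMap.congr_fun (congrArg ModuleCat.Hom.hom h2) v
  · rintro ⟨ψ, hψ⟩
    have : ModuleCat.ofHom φ = P.map.shortComplexKer.f ≫ ModuleCat.ofHom ψ := by
      refine ModuleCat.hom_ext (LinearMap.ext fun v => ?_)
      exact (hψ v).symm
    rw [connecting, this, ← Ext.mk₀_comp_mk₀]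
    exact ShortComplex.ShortExact.extClass_comp_assoc _ _

/-- Connecting maps are compatible with maps of presentations. -/
theorem connecting_comp (Q : GradedPresentation (ℓ := ℓ) ℳ)
    (g : (Fin Q.rank → Coord K ℓ) →ₗ[Coord K ℓ] (Fin P.rank → Coord K ℓ))
    (hg : ∀ v, P.map (g v) = Q.map v) (φ : LinearMap.ker P.map →ₗ[Coord K ℓ] Coord K ℓ)
    (hgk : ∀ v ∈ LinearMap.ker Q.map, g v ∈ LinearMap.ker P.map) :
    Q.connecting (φ.comp (g.restrict hgk)) = P.connecting φ := by
  let f : Q.map.shortComplexKer ⟶ P.map.shortComplexKer :=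
    { τ₁ := ModuleCat.ofHom (g.restrict hgk)
      τ₂ := ModuleCat.ofHom g
      τ₃ := 𝟙 _
      comm₁₂ := by ext; rfl
      comm₂₃ := ModuleCat.hom_ext (LinearMap.ext hg) }
  have h := ShortComplex.ShortExact.extClass_naturality
    (LinearMap.shortExact_shortComplexKer Q.map_surjective)
    (LinearMap.shortExact_shortComplexKer P.map_surjective) f
  rw [connecting, connecting, ModuleCat.ofHom_comp, ← Ext.mk₀_comp_mk₀]
  have h2 := congrArg (fun x => Ext.comp x (Ext.mk₀ (ModuleCat.ofHom φ)) (add_zero 1)) h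
  simp only [Ext.comp_assoc_of_third_deg_zero] at h2
  refine h2.trans ?_
  simp [f]

end GradedPresentation

end Ext

end

section

variable {K : Type u} [Field K] {ℓ : ℕ}

/-! ### Independence of the presentation -/

theorem linearMap_apply_eq_sum_single {R N ι : Type*} [CommSemiring R] [AddCommMonoid N]
    [Module R N] [Fintype ι] [DecidableEq ι] (g : (ι → R) →ₗ[R] N) (v : ι → R) :
    g v = ∑ i, v i • g (Pi.single i 1) := by
  rw [LinearMap.pi_apply_eq_sum_univ g v]
  refine Finset.sum_congr rfl fun i _ => ?_
  congr 2
  funext j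
  simp [Pi.single_apply, eq_comm]

namespace GradedPresentation

variable {f : Coord K ℓ} {n : ℕ}

/-- Any lift can be truncated to the right degrees. Clearing the denominator `f` turns the check
that it remains a lift into a comparison of components of polynomials. -/
theorem exists_homogeneous_lift (P : GradedPresentation (ℓ := ℓ) (relLogFormsPiece f n))
    (hf : f ≠ 0) {e : ℤ} {x : relLogForms f} (hx : x ∈ relLogFormsPiece f n e) :
    ∃ v : Fin P.rank → Coord K ℓ, P.map v = x ∧
      ∀ i, v i ∈ polyPiece (K := K) (ℓ := ℓ) (e - P.deg i) := by
  obtain ⟨v, hv⟩ := P.map_surjective x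
  have hP : ∀ v k, ((P.map v : relLogForms f) : RatForm K ℓ) k
      = ∑ i, toRat (v i) * ((P.map (Pi.single i 1) : relLogForms f) : RatForm K ℓ) k := by
    intro v k
    rw [linearMap_apply_eq_sum_single P.map v, Submodule.coe_sum, Finset.sum_apply]
    refine Finset.sum_congr rfl fun i _ => ?_
    rw [Submodule.coe_smul, Pi.smul_apply, Algebra.smul_def]
  refine ⟨fun i => polyComp (e - P.deg i) (v i), Subtype.ext (funext fun k => ?_),
    fun i => polyComp_mem _ _⟩
  obtain ⟨q, hq, hq'⟩ := hx k
  choose p hp hp' using fun i => P.map_single_mem i k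
  have hf0 := toRat_ne_zero hf
  have key : ∀ v : Fin P.rank → Coord K ℓ,
      toRat f * ((P.map v : relLogForms f) : RatForm K ℓ) k = toRat (∑ i, v i * p i) := by
    intro v
    rw [hP, Finset.mul_sum, map_sum]
    refine Finset.sum_congr rfl fun i _ => ?_
    rw [map_mul, hp' i]
    ring
  apply mul_left_cancel₀ hf0
  have h1 := key v
  rw [hv, ← hq'] at h1
  rw [key, ← hq', toRat_injective h1]
  congr 1
  rw [← polyComp_of_mem (toRat_injective h1 ▸ hq : ∑ i, v i * p i ∈ _), map_sum]
  exact Finset.sum_congr rfl fun i _ => (polyComp_mul (by ring) _ (hp i)).symm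

theorem exists_connecting_eq (P Q : GradedPresentation (ℓ := ℓ) (relLogFormsPiece f n))
    (hf : f ≠ 0) {d : ℤ} {φ : LinearMap.ker P.map →ₗ[Coord K ℓ] Coord K ℓ}
    (hφ : P.IsHomogeneousHom d φ) :
    ∃ ψ : LinearMap.ker Q.map →ₗ[Coord K ℓ] Coord K ℓ,
      Q.IsHomogeneousHom d ψ ∧ Q.connecting ψ = P.connecting φ := by
  choose v hv hv' using fun j => P.exists_homogeneous_lift hf (Q.map_single_mem j)
  let g := Fintype.linearCombination (Coord K ℓ) v
  have hg : ∀ u, P.map (g u) = Q.map u := by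
    intro u
    rw [linearMap_apply_eq_sum_single Q.map u, Fintype.linearCombination_apply, map_sum]
    refine Finset.sum_congr rfl fun j _ => ?_
    rw [map_smul, hv]
  have hgk : ∀ u ∈ LinearMap.ker Q.map, g u ∈ LinearMap.ker P.map := by
    intro u hu
    rw [LinearMap.mem_ker, hg]
    exact hu
  refine ⟨φ.comp (g.restrict hgk), fun m u hu => hφ m _ fun i => ?_,
    P.connecting_comp Q g hg φ hgk⟩
  change g u i ∈ _
  rw [Fintype.linearCombination_apply, Finset.sum_apply]
  exact Submodule.sum_mem _ fun j _ => mul_mem_polyPiece (by ring) (hu j) (hv' j i)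

/-- Homogeneous lifts transport classes between presentations, so a single presentation computes the
whole piece, and its classes already form a subspace. -/
theorem mem_extOnePiece_iff (Q : GradedPresentation (ℓ := ℓ) (relLogFormsPiece f n))
    (hf : f ≠ 0) {d : ℤ} {x : ExtOne (ℓ := ℓ) (K := K) (relLogForms f)} :
    x ∈ extOnePiece (relLogFormsPiece f n) d ↔
      ∃ ψ, Q.IsHomogeneousHom d ψ ∧ Q.connecting ψ = x := by
  constructor
  · intro hx
    induction hx using Submodule.span_induction with
    | mem x hx =>
      obtain ⟨P, φ, hφ, rfl⟩ := hx
      exact P.exists_connecting_eq Q hf hφ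
    | zero => exact ⟨0, fun _ _ _ => Submodule.zero_mem _, Q.connectingₗ.map_zero⟩
    | add x y _ _ hx hy =>
      obtain ⟨φ, hφ, rfl⟩ := hx
      obtain ⟨ψ, hψ, rfl⟩ := hy
      exact ⟨φ + ψ, fun m v hv => Submodule.add_mem _ (hφ m v hv) (hψ m v hv),
        Q.connectingₗ.map_add φ ψ⟩
    | smul c x _ hx =>
      obtain ⟨φ, hφ, rfl⟩ := hx
      refine ⟨(C c : Coord K ℓ) • φ, fun m v hv => ?_,
        (Q.connectingₗ.map_smul _ φ).trans (C_smul_extOne _ _)⟩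
      rw [LinearMap.smul_apply, smul_eq_mul, ← smul_eq_C_mul]
      exact Submodule.smul_mem _ c (hφ m v hv)
  · rintro ⟨ψ, hψ, rfl⟩
    exact Submodule.subset_span ⟨Q, ψ, hψ, rfl⟩

end GradedPresentation

/-! ### The presentation of the module of relative logarithmic forms -/

theorem linForm_mem_polyPiece (a : Fin ℓ → K) : linForm a ∈ polyPiece (K := K) (ℓ := ℓ) 1 :=
  (mem_polyPiece_natCast 1 _).2 (linForm_isHomogeneous a)

theorem C_mem_polyPiece (c : K) : (C c : Coord K ℓ) ∈ polyPiece (K := K) (ℓ := ℓ) 0 :=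
  (mem_polyPiece_natCast 0 _).2 (isHomogeneous_C _ c)

theorem coPoly_mem_polyPiece {m : ℕ} (α : Fin (m + 1) → Fin 3 → K) (j : Fin (m + 1)) :
    coPoly α j ∈ polyPiece (K := K) (ℓ := 3) m := by
  rw [mem_polyPiece_natCast]
  have := IsHomogeneous.prod (Finset.univ.erase j) (fun k => linForm (α k)) (fun _ => 1)
    fun k _ => linForm_isHomogeneous _
  simpa [coPoly, Finset.card_erase_of_mem] using this

theorem relDlog_mem {m : ℕ} (α : Fin (m + 1) → Fin 3 → K) (h : ∀ j, α j ≠ 0) (i : Fin m) :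
    relDlog α h i ∈ arrFormsPiece α 0 := by
  intro k
  refine ⟨coPoly α i.succ * C (α i.succ k) - coPoly α 0 * C (α 0 k), ?_, ?_⟩
  · exact Submodule.sub_mem _
      (mul_mem_polyPiece (by push_cast; ring) (coPoly_mem_polyPiece α _) (C_mem_polyPiece _))
      (mul_mem_polyPiece (by push_cast; ring) (coPoly_mem_polyPiece α _) (C_mem_polyPiece _))
  · rw [map_sub, ← toRat_defPoly_mul_dlog (h _), ← toRat_defPoly_mul_dlog (h _), ← mul_sub]
    rfl

/-- The presentation of `Ω¹₀` by the forms `dα_{i+1} / α_{i+1} - dα_0 / α_0`. -/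
abbrev dlogPresentation {m : ℕ} {α : Fin (m + 1) → Fin 3 → K} (h : TripleIndep α) (hm : 3 ≤ m + 1) :
    GradedPresentation (ℓ := 3) (arrFormsPiece α) where
  rank := m
  deg _ := 0
  map := Fintype.linearCombination (Coord K 3) (relDlog α (h.ne_zero hm))
  map_surjective := relDlog_surjective h hm
  map_single_mem i := by
    rw [Fintype.linearCombination_apply_single, one_smul]
    exact relDlog_mem α _ i

end

section

variable {K : Type u} [Field K]

/-! ### Relations among the linear forms -/

theorem TripleIndep.base {N : ℕ} {α : Fin (N + 3) → Fin 3 → K} (h : TripleIndep α) :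
    LinearIndependent K ![α 0, α (Fin.succ 0), α (Fin.succ (Fin.succ 0))] :=
  h _ _ _ (Fin.succ_ne_zero _).symm (Fin.succ_ne_zero _).symm
    fun e => Fin.succ_ne_zero _ (Fin.succ_injective _ e).symm

/-- A basis of the relations among the vectors `α j`, normalized on the last `N` coordinates. -/
structure IsRelationBasis {N : ℕ} (α : Fin (N + 3) → Fin 3 → K) (B : Fin N → Fin (N + 3) → K) :
    Prop where
  apply_succ : ∀ r r', B r r'.succ.succ.succ = (Pi.single r 1 : Fin N → K) r'
  relation : ∀ r i, ∑ j, B r j * α j i = 0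

theorem sum_univ_three_add {R : Type*} [AddCommMonoid R] {N : ℕ} (F : Fin (N + 3) → R) :
    ∑ j, F j = F 0 + (F (Fin.succ 0) + (F (Fin.succ (Fin.succ 0)) +
      ∑ r : Fin N, F r.succ.succ.succ)) := by
  rw [Fin.sum_univ_succ, Fin.sum_univ_succ, Fin.sum_univ_succ]

theorem forall_fin_three_add {N : ℕ} {P : Fin (N + 3) → Prop} (h0 : P 0) (h1 : P (Fin.succ 0))
    (h2 : P (Fin.succ (Fin.succ 0))) (h3 : ∀ r : Fin N, P r.succ.succ.succ) (j : Fin (N + 3)) :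
    P j :=
  Fin.cases h0 (fun j => Fin.cases h1 (fun j => Fin.cases h2 h3 j) j) j

theorem TripleIndep.exists_isRelationBasis {N : ℕ} {α : Fin (N + 3) → Fin 3 → K}
    (h : TripleIndep α) : ∃ B, IsRelationBasis α B := by
  obtain ⟨u, v, w, H⟩ := exists_dual_basis h.base
  -- Each later vector is expanded in the basis formed by the first three; the negated coordinates
  -- together with a `1` at its own place give a relation.
  refine ⟨fun r => Fin.cons (-(α r.succ.succ.succ ⬝ᵥ u)) (Fin.cons (-(α r.succ.succ.succ ⬝ᵥ v))
    (Fin.cons (-(α r.succ.succ.succ ⬝ᵥ w)) (Pi.single r 1))), fun r r' => ?_, fun r i => ?_⟩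
  · simp only [Fin.cons_succ]
  · have e := congrFun (H (α r.succ.succ.succ)) i
    rw [sum_univ_three_add]
    simp only [Fin.cons_succ, Fin.cons_zero, Pi.add_apply, Pi.smul_apply, smul_eq_mul] at e ⊢
    rw [Finset.sum_eq_single r (by simp +contextual) (by simp), Pi.single_eq_same]
    linear_combination e

variable {N : ℕ} {α : Fin (N + 3) → Fin 3 → K} {B : Fin N → Fin (N + 3) → K}

theorem sum_mul_C_dotProduct (z : Coord K 3) (a u : Fin 3 → K) :
    ∑ i, z * C (a i) * C (u i) = z * C (a ⬝ᵥ u) := by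
  simp only [dotProduct, map_sum, map_mul, Finset.mul_sum, mul_assoc]

theorem eq_zero_of_combination {a b c : Fin 3 → K} (h : LinearIndependent K ![a, b, c])
    {x y z : Coord K 3} (H : ∀ i, x * C (a i) + y * C (b i) + z * C (c i) = 0) :
    x = 0 ∧ y = 0 ∧ z = 0 := by
  obtain ⟨u, v, w, D⟩ := exists_dual_basis h
  obtain ⟨⟨h1, h2, h3⟩, ⟨h4, h5, h6⟩, h7, h8, h9⟩ := dual_basis_apply_all h D
  have key : ∀ t : Fin 3 → K, x * C (a ⬝ᵥ t) + y * C (b ⬝ᵥ t) + z * C (c ⬝ᵥ t) = 0 := by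
    intro t
    simp only [← sum_mul_C_dotProduct, ← Finset.sum_add_distrib, ← add_mul, H, zero_mul,
      Finset.sum_const_zero]
  have hu := key u
  have hv := key v
  have hw := key w
  simp only [h1, h2, h3, h4, h5, h6, h7, h8, h9, map_zero, map_one, mul_zero, mul_one, add_zero,
    zero_add] at hu hv hw
  exact ⟨hu, hv, hw⟩

namespace IsRelationBasis

theorem sum_apply_succ (hB : IsRelationBasis α B) (y : Fin N → Coord K 3) (r : Fin N) :
    ∑ r', y r' * C (B r' r.succ.succ.succ) = y r := by
  rw [Finset.sum_eq_single r]
  · simp [hB.apply_succ]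
  · intro r' _ hr
    simp [hB.apply_succ, hr.symm]
  · simp

theorem sum_relation (hB : IsRelationBasis α B) (y : Fin N → Coord K 3) (i : Fin 3) :
    ∑ j, (∑ r, y r * C (B r j)) * C (α j i) = 0 := by
  simp only [Finset.sum_mul, mul_assoc, ← C_mul]
  rw [Finset.sum_comm]
  simp only [← Finset.mul_sum, ← map_sum, hB.relation, map_zero, mul_zero, Finset.sum_const_zero]

/-- Polynomial relations are combinations of the constant ones. -/
theorem eq_sum (hB : IsRelationBasis α B) (h : TripleIndep α) {b : Fin (N + 3) → Coord K 3}
    (hb : ∀ i, ∑ j, b j * C (α j i) = 0) (j : Fin (N + 3)) :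
    b j = ∑ r, b r.succ.succ.succ * C (B r j) := by
  have h1 : ∀ i, ∑ j, (b j - ∑ r, b r.succ.succ.succ * C (B r j)) * C (α j i) = 0 := by
    intro i
    simp only [sub_mul, Finset.sum_sub_distrib, hb]
    rw [hB.sum_relation, sub_zero]
  have h2 : ∀ r : Fin N, b r.succ.succ.succ
      - ∑ r', b r'.succ.succ.succ * C (B r' r.succ.succ.succ) = 0 := by
    intro r
    rw [hB.sum_apply_succ (fun r => b r.succ.succ.succ), sub_self]
  simp only [sum_univ_three_add, h2, zero_mul, Finset.sum_const_zero, add_zero, ← add_assoc] at h1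
  obtain ⟨e0, e1, e2⟩ := eq_zero_of_combination h.base h1
  rw [← sub_eq_zero]
  exact forall_fin_three_add (P := fun j => b j - ∑ r, b r.succ.succ.succ * C (B r j) = 0)
    e0 e1 e2 h2 j

/-- Polynomial vectors orthogonal to the relations are combinations of the rows. -/
theorem exists_eq_sum (hB : IsRelationBasis α B) (h : TripleIndep α) {k : ℤ}
    {z : Fin (N + 3) → Coord K 3} (hz : ∀ j, z j ∈ polyPiece (K := K) (ℓ := 3) k)
    (hzB : ∀ r, ∑ j, z j * C (B r j) = 0) :
    ∃ p : Fin 3 → Coord K 3, (∀ i, p i ∈ polyPiece (K := K) (ℓ := 3) k) ∧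
      ∀ j, z j = ∑ i, p i * C (α j i) := by
  obtain ⟨u, v, w, D⟩ := exists_dual_basis h.base
  obtain ⟨⟨h1, h2, h3⟩, ⟨h4, h5, h6⟩, h7, h8, h9⟩ := dual_basis_apply_all h.base D
  let p : Fin 3 → Coord K 3 := fun i =>
    z 0 * C (u i) + z (Fin.succ 0) * C (v i) + z (Fin.succ (Fin.succ 0)) * C (w i)
  have hp : ∀ a : Fin 3 → K, ∑ i, p i * C (a i) = z 0 * C (a ⬝ᵥ u) +
      z (Fin.succ 0) * C (a ⬝ᵥ v) + z (Fin.succ (Fin.succ 0)) * C (a ⬝ᵥ w) := by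
    intro a
    simp only [← sum_mul_C_dotProduct, ← Finset.sum_add_distrib, p]
    exact Finset.sum_congr rfl fun i _ => by ring
  have e0 : z 0 - ∑ i, p i * C (α 0 i) = 0 := by
    rw [hp, h1, h2, h3]; simp
  have e1 : z (Fin.succ 0) - ∑ i, p i * C (α (Fin.succ 0) i) = 0 := by
    rw [hp, h4, h5, h6]; simp
  have e2 : z (Fin.succ (Fin.succ 0)) - ∑ i, p i * C (α (Fin.succ (Fin.succ 0)) i) = 0 := by
    rw [hp, h7, h8, h9]; simp
  have e3 : ∀ r, ∑ j, (z j - ∑ i, p i * C (α j i)) * C (B r j) = 0 := by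
    intro r
    simp only [sub_mul, Finset.sum_sub_distrib, hzB, Finset.sum_mul, mul_assoc, ← C_mul]
    rw [Finset.sum_comm]
    simp only [← Finset.mul_sum, ← map_sum, mul_comm (α _ _), hB.relation]
    simp
  refine ⟨p, fun i => Submodule.add_mem _ (Submodule.add_mem _
    (mul_mem_polyPiece (add_zero k) (hz _) (C_mem_polyPiece _))
    (mul_mem_polyPiece (add_zero k) (hz _) (C_mem_polyPiece _)))
    (mul_mem_polyPiece (add_zero k) (hz _) (C_mem_polyPiece _)), fun j => sub_eq_zero.1 ?_⟩
  refine forall_fin_three_add (P := fun j => z j - ∑ i, p i * C (α j i) = 0) e0 e1 e2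
    (fun r => ?_) j
  have := e3 r
  rw [sum_univ_three_add, e0, e1, e2] at this
  simp only [hB.apply_succ, zero_mul, zero_add] at this
  rw [Finset.sum_eq_single r (fun r' _ hr => by simp [hr]) (by simp), Pi.single_eq_same, map_one,
    mul_one] at this
  exact this

end IsRelationBasis

/-! ### The free module of relations and `Ext¹` as the cokernel of the transpose -/

/-- The linear map `S^N → S^(N+2)` that parametrizes the relations among the generators of
`Ω¹₀`. -/
def relationMap (α : Fin (N + 3) → Fin 3 → K) (B : Fin N → Fin (N + 3) → K) :
    (Fin N → Coord K 3) →ₗ[Coord K 3] (Fin (N + 2) → Coord K 3) :=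
  Fintype.linearCombination (Coord K 3) fun r i => linForm (α i.succ) * C (B r i.succ)

theorem relationMap_apply (y : Fin N → Coord K 3) (i : Fin (N + 2)) :
    relationMap α B y i = linForm (α i.succ) * ∑ r, y r * C (B r i.succ) := by
  rw [relationMap, Fintype.linearCombination_apply, Finset.sum_apply, Finset.mul_sum]
  exact Finset.sum_congr rfl fun r _ => by simp only [Pi.smul_apply, smul_eq_mul]; ring

theorem IsRelationBasis.relationMap_apply_succ (hB : IsRelationBasis α B) (y : Fin N → Coord K 3)
    (r : Fin N) : relationMap α B y r.succ.succ = linForm (α r.succ.succ.succ) * y r := by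
  rw [relationMap_apply, hB.sum_apply_succ]

theorem IsRelationBasis.relationMap_injective (hB : IsRelationBasis α B) (h : TripleIndep α) :
    Function.Injective (relationMap α B) := by
  intro y y' hy
  funext r
  have := congrFun hy r.succ.succ
  rw [hB.relationMap_apply_succ, hB.relationMap_apply_succ] at this
  exact mul_left_cancel₀ (linForm_ne_zero (h.ne_zero (by omega) _)) this

/-- Relations among the differences are relations among all the `dlog (α j)` with coefficient sum
zero. -/
theorem IsRelationBasis.mem_ker_iff (hB : IsRelationBasis α B) (h : TripleIndep α)
    (hm : 3 ≤ N + 2 + 1) (v : Fin (N + 2) → Coord K 3) :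
    v ∈ LinearMap.ker (dlogPresentation h hm).map ↔ ∃ y, relationMap α B y = v := by
  have e : v ∈ LinearMap.ker (dlogPresentation h hm).map ↔
      ∑ j, extendZero v j • dlog (α j) = 0 := by
    rw [← coe_linearCombination_relDlog α (h.ne_zero hm) v, ZeroMemClass.coe_eq_zero,
      LinearMap.mem_ker]
  rw [e, h.sum_smul_dlog_eq_zero_iff hm]
  constructor
  · rintro ⟨b, hb, hb'⟩
    refine ⟨fun r => b r.succ.succ.succ, funext fun i => ?_⟩
    rw [relationMap_apply, ← hB.eq_sum h hb', ← hb]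
    simp [extendZero]
  · rintro ⟨y, rfl⟩
    have hs : ∀ i : Fin (N + 2), extendZero (relationMap α B y) i.succ
        = linForm (α i.succ) * ∑ r, y r * C (B r i.succ) := by
      intro i
      rw [← relationMap_apply]
      simp [extendZero]
    refine ⟨fun j => ∑ r, y r * C (B r j), fun j => ?_, hB.sum_relation y⟩
    refine Fin.cases ?_ hs j
    -- Contracting the vector relation `∑ b_j α_j = 0` with `(x_i)` shows that the coefficients `α_j
    -- b_j` sum to zero, which settles the coordinate `0`.
    have h0 : ∑ j, linForm (α j) * ∑ r, y r * C (B r j) = 0 := by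
      simp only [linForm, Finset.sum_mul]
      rw [Finset.sum_comm]
      refine Finset.sum_eq_zero fun i _ => ?_
      rw [← mul_zero (X i : Coord K 3), ← hB.sum_relation y i, Finset.mul_sum]
      exact Finset.sum_congr rfl fun j _ => by ring
    rw [Fin.sum_univ_succ] at h0
    rw [eq_neg_of_add_eq_zero_left h0]
    simp only [extendZero, Fin.cons_zero, relationMap_apply]

/-- The module of relations is free. -/
def IsRelationBasis.equivKer (hB : IsRelationBasis α B) (h : TripleIndep α)
    (hm : 3 ≤ N + 2 + 1) :
    (Fin N → Coord K 3) ≃ₗ[Coord K 3] LinearMap.ker (dlogPresentation h hm).map :=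
  LinearEquiv.ofBijective ((relationMap α B).codRestrict (LinearMap.ker (dlogPresentation h hm).map)
    fun y => (hB.mem_ker_iff h hm _).2 ⟨y, rfl⟩)
    ⟨fun _ _ e => hB.relationMap_injective h (congrArg Subtype.val e), fun v =>
      let ⟨y, hy⟩ := (hB.mem_ker_iff h hm _).1 v.2
      ⟨y, Subtype.ext hy⟩⟩

theorem IsRelationBasis.coe_equivKer (hB : IsRelationBasis α B) (h : TripleIndep α)
    (hm : 3 ≤ N + 2 + 1) (y : Fin N → Coord K 3) :
    (hB.equivKer h hm y : Fin (N + 2) → Coord K 3) = relationMap α B y := rfl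

/-- `Ext¹(Ω¹₀, S)` as a quotient of `S^N`. -/
def IsRelationBasis.toExt (hB : IsRelationBasis α B) (h : TripleIndep α) (hm : 3 ≤ N + 2 + 1) :
    (Fin N → Coord K 3) →ₗ[Coord K 3] ExtOne (ℓ := 3) (K := K) (arrForms α) :=
  (dlogPresentation h hm).connectingₗ ∘ₗ
    (LinearMap.lcomp (Coord K 3) (Coord K 3) (hB.equivKer h hm).symm.toLinearMap) ∘ₗ
      ((Pi.basisFun (Coord K 3) (Fin N)).constr (Coord K 3)).toLinearMap

/-- The linear form on the module of relations with given values on the basis. -/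
def IsRelationBasis.form (hB : IsRelationBasis α B) (h : TripleIndep α) (hm : 3 ≤ N + 2 + 1)
    (y : Fin N → Coord K 3) :
    LinearMap.ker (dlogPresentation h hm).map →ₗ[Coord K 3] Coord K 3 :=
  ((Pi.basisFun (Coord K 3) (Fin N)).constr (Coord K 3) y).comp
    (hB.equivKer h hm).symm.toLinearMap

theorem IsRelationBasis.toExt_apply (hB : IsRelationBasis α B) (h : TripleIndep α)
    (hm : 3 ≤ N + 2 + 1) (y : Fin N → Coord K 3) :
    hB.toExt h hm y = (dlogPresentation h hm).connecting (hB.form h hm y) := rfl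

theorem IsRelationBasis.form_equivKer (hB : IsRelationBasis α B) (h : TripleIndep α)
    (hm : 3 ≤ N + 2 + 1) (y u : Fin N → Coord K 3) :
    hB.form h hm y (hB.equivKer h hm u) = ∑ r, u r * y r := by
  simp [form, Module.Basis.constr_apply_fintype]

theorem IsRelationBasis.form_surjective (hB : IsRelationBasis α B) (h : TripleIndep α)
    (hm : 3 ≤ N + 2 + 1) : Function.Surjective (hB.form h hm) := by
  intro φ
  refine ⟨fun r => φ (hB.equivKer h hm (Pi.single r 1)), LinearMap.ext fun v => ?_⟩
  obtain ⟨u, rfl⟩ := (hB.equivKer h hm).surjective v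
  rw [form_equivKer]
  exact (linearMap_apply_eq_sum_single (φ ∘ₗ (hB.equivKer h hm).toLinearMap) u).symm

theorem IsRelationBasis.toExt_surjective (hB : IsRelationBasis α B) (h : TripleIndep α)
    (hm : 3 ≤ N + 2 + 1) : Function.Surjective (hB.toExt h hm) :=
  (dlogPresentation h hm).connecting_surjective.comp (hB.form_surjective h hm)

/-- The transpose of `relationMap`. -/
def corelationMap (α : Fin (N + 3) → Fin 3 → K) (B : Fin N → Fin (N + 3) → K) :
    (Fin (N + 2) → Coord K 3) →ₗ[Coord K 3] (Fin N → Coord K 3) :=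
  Fintype.linearCombination (Coord K 3) fun i r => linForm (α i.succ) * C (B r i.succ)

theorem corelationMap_apply (q : Fin (N + 2) → Coord K 3) (r : Fin N) :
    corelationMap α B q r = ∑ i, q i * (linForm (α i.succ) * C (B r i.succ)) := by
  rw [corelationMap, Fintype.linearCombination_apply, Finset.sum_apply]
  rfl

theorem sum_mul_corelationMap (q : Fin (N + 2) → Coord K 3) (u : Fin N → Coord K 3) :
    ∑ r, u r * corelationMap α B q r = ∑ i, relationMap α B u i * q i := by
  simp only [corelationMap_apply, relationMap_apply, Finset.mul_sum, Finset.sum_mul]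
  rw [Finset.sum_comm]
  exact Finset.sum_congr rfl fun i _ => Finset.sum_congr rfl fun r _ => by ring

/-- A class dies exactly when its form extends to the free module; restricting the form with values
`q` to the relations gives the transpose applied to `q`. -/
theorem IsRelationBasis.toExt_eq_zero_iff (hB : IsRelationBasis α B) (h : TripleIndep α)
    (hm : 3 ≤ N + 2 + 1) (y : Fin N → Coord K 3) :
    hB.toExt h hm y = 0 ↔ ∃ q, corelationMap α B q = y := by
  rw [toExt_apply, GradedPresentation.connecting_eq_zero_iff]
  constructor
  · rintro ⟨ψ, hψ⟩
    refine ⟨fun i => ψ (Pi.single i 1), funext fun r => ?_⟩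
    have h1 := hψ (hB.equivKer h hm (Pi.single r 1))
    rw [form_equivKer, coe_equivKer, linearMap_apply_eq_sum_single] at h1
    have h2 := sum_mul_corelationMap (α := α) (B := B) (fun i => ψ (Pi.single i 1)) (Pi.single r 1)
    have h3 : ∀ y : Fin N → Coord K 3, ∑ r', (Pi.single r 1 : Fin N → Coord K 3) r' * y r' = y r :=
      fun y => by simp [Pi.single_apply]
    rw [h3] at h1 h2
    exact h2.trans h1
  · rintro ⟨q, rfl⟩
    refine ⟨Fintype.linearCombination (Coord K 3) q, fun v => ?_⟩
    obtain ⟨u, rfl⟩ := (hB.equivKer h hm).surjective v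
    rw [form_equivKer, sum_mul_corelationMap, coe_equivKer, Fintype.linearCombination_apply]
    rfl

theorem mem_polyPiece_of_mul {ℓ : ℕ} {p q : Coord K ℓ} {a b k : ℤ} (h : a + b = k) (hq0 : q ≠ 0)
    (hq : q ∈ polyPiece (K := K) (ℓ := ℓ) b) (hpq : p * q ∈ polyPiece (K := K) (ℓ := ℓ) k) :
    p ∈ polyPiece (K := K) (ℓ := ℓ) a := by
  have e := polyComp_mul h p hq
  rw [polyComp_of_mem hpq] at e
  rw [mul_right_cancel₀ hq0 e]
  exact polyComp_mem _ _

/-- The shift by one arises because the basic relations have degree 1: their entries are scalar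
multiples of the `α j` and the generators have degree 0. -/
theorem IsRelationBasis.isHomogeneousHom_form_iff (hB : IsRelationBasis α B) (h : TripleIndep α)
    (hm : 3 ≤ N + 2 + 1) (y : Fin N → Coord K 3) (d : ℤ) :
    (dlogPresentation h hm).IsHomogeneousHom d (hB.form h hm y) ↔
      ∀ r, y r ∈ polyPiece (K := K) (ℓ := 3) (d + 1) := by
  constructor
  · intro H r
    have h1 := H 1 (hB.equivKer h hm (Pi.single r 1)) fun i => ?_
    · rw [form_equivKer, add_comm] at h1
      simpa [Pi.single_apply] using h1
    · rw [coe_equivKer, relationMap_apply]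
      refine mul_mem_polyPiece (a := 1) (b := 0) (by simp) (linForm_mem_polyPiece _)
        (Submodule.sum_mem _ fun r' _ => ?_)
      exact mul_mem_polyPiece (a := 0) (b := 0) (add_zero 0) (by
        rw [Pi.single_apply]
        split_ifs
        · exact C_mem_polyPiece (1 : K)
        · exact Submodule.zero_mem _) (C_mem_polyPiece _)
  · intro H m v hv
    obtain ⟨u, rfl⟩ := (hB.equivKer h hm).surjective v
    rw [form_equivKer]
    refine Submodule.sum_mem _ fun r _ => mul_mem_polyPiece (a := m - 1) (by ring) ?_ (H r)
    -- By the normalization of `B`, this coordinate is `u r` times a linear form, so `u r` is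
    -- homogeneous of degree `m - 1`.
    have h1 := hv r.succ.succ
    rw [coe_equivKer, hB.relationMap_apply_succ, mul_comm] at h1
    exact mem_polyPiece_of_mul (b := 1) (k := m - 0) (by ring)
      (linForm_ne_zero (h.ne_zero hm _)) (linForm_mem_polyPiece _) h1

theorem IsRelationBasis.mem_extOnePiece_iff (hB : IsRelationBasis α B) (h : TripleIndep α)
    (hm : 3 ≤ N + 2 + 1) (d : ℤ) (x : ExtOne (ℓ := 3) (K := K) (arrForms α)) :
    x ∈ extOnePiece (ℓ := 3) (arrFormsPiece α) d ↔
      ∃ y : Fin N → Coord K 3, (∀ r, y r ∈ polyPiece (K := K) (ℓ := 3) (d + 1)) ∧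
        hB.toExt h hm y = x := by
  rw [GradedPresentation.mem_extOnePiece_iff (dlogPresentation h hm) (h.defPoly_ne_zero hm),
    (hB.form_surjective h hm).exists]
  simp only [isHomogeneousHom_form_iff, toExt_apply]

end

/-! ### Injectivity of the transpose in low degrees -/

section

variable {K : Type u} [Field K]

theorem polyComp_of_neg {ℓ : ℕ} {k : ℤ} (hk : k < 0) (p : Coord K ℓ) : polyComp k p = 0 := by
  ext m
  rw [coeff_polyComp, if_neg (by omega), coeff_zero]

theorem X_mem_polyPiece {ℓ : ℕ} (i : Fin ℓ) : (X i : Coord K ℓ) ∈ polyPiece (K := K) (ℓ := ℓ) 1 :=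
  (mem_polyPiece_natCast 1 _).2 (isHomogeneous_X K i)

/-- Logarithmic numerators of low degree vanish. -/
theorem TripleIndep.eq_zero_of_low_degree {m : ℕ} {α : Fin (m + 1) → Fin 3 → K}
    (h : TripleIndep α) (hm : 3 ≤ m + 1) {k : ℤ} (hk : k < m) {w : Fin 3 → Coord K 3}
    (hw : ∀ i, w i ∈ polyPiece (K := K) (ℓ := 3) k)
    (hdvd : ∀ j i i', linForm (α j) ∣ C (α j i) * w i' - C (α j i') * w i) : w = 0 := by
  obtain ⟨c, hc⟩ := h.exists_eq_sum hm hdvd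
  funext i
  rw [← polyComp_of_mem (hw i), hc i, map_sum]
  refine Finset.sum_eq_zero fun j _ => ?_
  rw [polyComp_mul (sub_add_cancel k m) _
    (mul_mem_polyPiece (add_zero _) (coPoly_mem_polyPiece α j) (C_mem_polyPiece _)),
    polyComp_of_neg (by omega), zero_mul]

/-- Vectors of polynomials parallel to the Euler field are multiples of it. -/
theorem exists_eq_mul_X {p : Fin 3 → Coord K 3} (h01 : X 0 * p 1 = X 1 * p 0)
    (h02 : X 0 * p 2 = X 2 * p 0) : ∃ g, ∀ i, p i = g * X i := by
  have hX : Prime (X 0 : Coord K 3) := by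
    rw [← linForm_single]
    exact prime_linForm (by simp)
  have h1 : (X 0 : Coord K 3) ∣ p 0 := by
    refine (hX.dvd_mul.1 (Dvd.intro _ h01)).resolve_left fun h => ?_
    simp [X_dvd_X] at h
  obtain ⟨g, hg⟩ := h1
  refine ⟨g, fun i => ?_⟩
  apply mul_left_cancel₀ hX.ne_zero
  fin_cases i
  · simp only [Fin.zero_eta, hg]; ring
  · simp only [Fin.mk_one, h01, hg]; ring
  · change X 0 * p 2 = X 0 * (g * X 2)
    rw [h02, hg]; ring

variable {N : ℕ} {α : Fin (N + 3) → Fin 3 → K} {B : Fin N → Fin (N + 3) → K}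

/-- Derivations of low degree tangent to all planes are multiples of the Euler field. -/
theorem TripleIndep.exists_eq_mul_X_of_low_degree (h : TripleIndep α) {k : ℤ} (hk : k ≤ N)
    {p : Fin 3 → Coord K 3} (hp : ∀ i, p i ∈ polyPiece (K := K) (ℓ := 3) k)
    (hd : ∀ j, linForm (α j) ∣ ∑ i, p i * C (α j i)) : ∃ g, ∀ i, p i = g * X i := by
  have hm : ∀ i i', X i * p i' ∈ polyPiece (K := K) (ℓ := 3) (k + 1) := fun i i' =>
    mul_mem_polyPiece (add_comm 1 k) (X_mem_polyPiece i) (hp i')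
  -- Here `w = x × p`. By `α × (x × p) = (α·p) x - (α·x) p`, where `α_j` divides `α_j·p` and `α_j·x`
  -- is `linForm (α j)`, the congruences hold; the degree `k + 1 ≤ N + 1` is below that of `coPoly`,
  -- which is `N + 2`.
  have hw := h.eq_zero_of_low_degree (by omega) (k := k + 1) (by push_cast; omega)
    (w := ![X 1 * p 2 - X 2 * p 1, X 2 * p 0 - X 0 * p 2, X 0 * p 1 - X 1 * p 0])
    (fun i => by
      fin_cases i
      · exact Submodule.sub_mem _ (hm 1 2) (hm 2 1)
      · exact Submodule.sub_mem _ (hm 2 0) (hm 0 2)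
      · exact Submodule.sub_mem _ (hm 0 1) (hm 1 0)) fun j i i' => by
    obtain ⟨z, hz⟩ := hd j
    rw [Fin.sum_univ_three] at hz
    have hl : linForm (α j) = C (α j 0) * X 0 + C (α j 1) * X 1 + C (α j 2) * X 2 :=
      Fin.sum_univ_three _
    fin_cases i <;> fin_cases i'
    · exact ⟨0, by simp⟩
    · exact ⟨X 2 * z - p 2, by simp; linear_combination X 2 * hz + p 2 * hl⟩
    · exact ⟨p 1 - X 1 * z, by simp; linear_combination -X 1 * hz - p 1 * hl⟩
    · exact ⟨p 2 - X 2 * z, by simp; linear_combination -X 2 * hz - p 2 * hl⟩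
    · exact ⟨0, by simp⟩
    · exact ⟨X 0 * z - p 0, by simp; linear_combination X 0 * hz + p 0 * hl⟩
    · exact ⟨X 1 * z - p 1, by simp; linear_combination X 1 * hz + p 1 * hl⟩
    · exact ⟨p 0 - X 0 * z, by simp; linear_combination -X 0 * hz - p 0 * hl⟩
    · exact ⟨0, by simp⟩
  have h1 := congrFun hw 1
  have h2 := congrFun hw 2
  simp only [Matrix.cons_val, Pi.zero_apply] at h1 h2
  exact exists_eq_mul_X (sub_eq_zero.1 h2) (sub_eq_zero.1 h1).symm

/-- With a zero put in front, the products `q_j α_j` are orthogonal to all relations, hence are the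
values on the `α_j` of one derivation `p`. It is tangent to every plane and of degree `k + 1 ≤ N`,
so it equals `g` times the Euler field; then every `q_j` is `g`, and `q_0 = 0`. -/
theorem IsRelationBasis.corelationMap_eq_zero (hB : IsRelationBasis α B) (h : TripleIndep α)
    {k : ℤ} (hk : k < N) {q : Fin (N + 2) → Coord K 3}
    (hq : ∀ i, q i ∈ polyPiece (K := K) (ℓ := 3) k) (h0 : corelationMap α B q = 0) : q = 0 := by
  let q' : Fin (N + 3) → Coord K 3 := Fin.cons 0 q
  have hq' : ∀ j, q' j ∈ polyPiece (K := K) (ℓ := 3) k := fun j =>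
    Fin.cases (Submodule.zero_mem _) hq j
  obtain ⟨p, hp, hpz⟩ := hB.exists_eq_sum h (k := k + 1) (z := fun j => q' j * linForm (α j))
    (fun j => mul_mem_polyPiece rfl (hq' j) (linForm_mem_polyPiece _)) fun r => by
      have := congrFun h0 r
      rw [corelationMap_apply] at this
      rw [Fin.sum_univ_succ]
      simp only [q', Fin.cons_zero, Fin.cons_succ, zero_mul, zero_add]
      simpa only [mul_assoc, Pi.zero_apply] using this
  obtain ⟨g, hg⟩ := h.exists_eq_mul_X_of_low_degree (by omega) hp fun j => by
    rw [← hpz j]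
    exact Dvd.intro_left _ rfl
  have hl : ∀ j, q' j = g := by
    intro j
    apply mul_right_cancel₀ (linForm_ne_zero (h.ne_zero (by omega) j))
    rw [hpz j, linForm, Finset.mul_sum]
    exact Finset.sum_congr rfl fun i _ => by rw [hg]; ring
  funext i
  exact (hl i.succ).trans (hl 0).symm

theorem polyComp_corelationMap (k : ℤ) (q : Fin (N + 2) → Coord K 3) (r : Fin N) :
    polyComp k (corelationMap α B q r)
      = corelationMap α B (fun i => polyComp (k - 1) (q i)) r := by
  rw [corelationMap_apply, corelationMap_apply, map_sum]
  exact Finset.sum_congr rfl fun i _ => polyComp_mul (by ring) _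
    (mul_mem_polyPiece (add_zero 1) (linForm_mem_polyPiece _) (C_mem_polyPiece _))

theorem corelationMap_mem {k : ℤ} {q : Fin (N + 2) → Coord K 3}
    (hq : ∀ i, q i ∈ polyPiece (K := K) (ℓ := 3) (k - 1)) (r : Fin N) :
    corelationMap α B q r ∈ polyPiece (K := K) (ℓ := 3) k := by
  rw [corelationMap_apply]
  exact Submodule.sum_mem _ fun i _ => mul_mem_polyPiece (sub_add_cancel k 1) (hq i)
    (mul_mem_polyPiece (add_zero 1) (linForm_mem_polyPiece _) (C_mem_polyPiece _))

/-! ### Dimensions -/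

theorem polyPiece_of_neg {ℓ : ℕ} {k : ℤ} (hk : k < 0) : polyPiece (K := K) (ℓ := ℓ) k = ⊥ := by
  refine (Submodule.eq_bot_iff _).2 fun p hp => ?_
  rw [← polyComp_of_mem hp, polyComp_of_neg hk]

theorem polyPiece_natCast_eq {ℓ : ℕ} (k : ℕ) : polyPiece (K := K) (ℓ := ℓ) k
    = restrictSupport K ((Finset.univ : Finset (Fin ℓ)).finsuppAntidiag k : Set (Fin ℓ →₀ ℕ)) := by
  ext p
  rw [mem_restrictSupport_iff]
  have : ∀ m : Fin ℓ →₀ ℕ, m ∈ (Finset.univ : Finset (Fin ℓ)).finsuppAntidiag k ↔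
      (m.degree : ℤ) = k := by
    intro m
    rw [Finset.mem_finsuppAntidiag, Finsupp.degree_eq_sum, Nat.cast_inj]
    simp
  constructor
  · intro hp m hm
    exact (this m).2 (hp m (mem_support_iff.1 hm))
  · intro hp m hm
    exact (this m).1 (hp (mem_support_iff.2 hm))

instance finiteDimensional_polyPiece {ℓ : ℕ} (k : ℤ) :
    FiniteDimensional K (polyPiece (K := K) (ℓ := ℓ) k) := by
  rcases lt_or_ge k 0 with hk | hk
  · rw [polyPiece_of_neg hk]
    infer_instance
  · obtain ⟨k, rfl⟩ := Int.eq_ofNat_of_zero_le hk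
    rw [polyPiece_natCast_eq]
    exact Module.Finite.of_basis (basisRestrictSupport K _)

theorem finrank_polyPiece (k : ℕ) :
    Module.finrank K (polyPiece (K := K) (ℓ := 3) k) = (k + 2).choose 2 := by
  rw [polyPiece_natCast_eq, Module.finrank_eq_nat_card_basis (basisRestrictSupport K _)]
  simp only [SetLike.coe_sort_coe, Nat.card_eq_fintype_card, Fintype.card_coe]
  rw [Finset.card_finsuppAntidiag_nat_eq_choose, Finset.card_univ, Fintype.card_fin,
    show 3 + k - 1 = k + 2 by omega, Nat.choose_symm_add]

/-- Vectors of homogeneous polynomials of degree `k`. -/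
def vecPiece (K : Type u) [Field K] (N : ℕ) (k : ℤ) : Submodule K (Fin N → Coord K 3) :=
  Submodule.pi Set.univ fun _ => polyPiece k

theorem mem_vecPiece {k : ℤ} {y : Fin N → Coord K 3} :
    y ∈ vecPiece K N k ↔ ∀ r, y r ∈ polyPiece (K := K) (ℓ := 3) k := by
  simp [vecPiece, Submodule.mem_pi]

/-- A vector of homogeneous polynomials, coordinatewise. -/
def vecPieceEquiv (N : ℕ) (k : ℤ) :
    vecPiece K N k ≃ₗ[K] (Fin N → polyPiece (K := K) (ℓ := 3) k) where
  toFun y r := ⟨y.1 r, mem_vecPiece.1 y.2 r⟩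
  invFun z := ⟨fun r => (z r).1, mem_vecPiece.2 fun r => (z r).2⟩
  map_add' _ _ := rfl
  map_smul' _ _ := rfl

instance (k : ℤ) : FiniteDimensional K (vecPiece K N k) :=
  Module.Finite.equiv (vecPieceEquiv N k).symm

theorem finrank_vecPiece (k : ℤ) : Module.finrank K (vecPiece K N k)
    = N * Module.finrank K (polyPiece (K := K) (ℓ := 3) k) := by
  rw [(vecPieceEquiv N k).finrank_eq, Module.finrank_pi_fintype]
  simp

end

section

variable {K : Type u} [Field K]

/-! ### Length and dimension -/

section Length

variable {σ : Type*}

theorem sub_C_constantCoeff_mem (p : MvPolynomial σ K) :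
    p - C (constantCoeff p) ∈ idealOfVars σ K := by
  rw [← pow_one (idealOfVars σ K), mem_pow_idealOfVars_iff']
  intro x hx
  have : x = 0 := by
    rw [← Finsupp.degree_eq_zero_iff]
    omega
  subst this
  simp [constantCoeff_eq]

/-- If the variables act by zero, submodules are the same as subspaces. -/
theorem length_eq_length_of_idealOfVars_smul_eq_zero {Q : Type*} [AddCommGroup Q]
    [Module (MvPolynomial σ K) Q] [Module K Q] [IsScalarTower K (MvPolynomial σ K) Q]
    (h : ∀ p ∈ idealOfVars σ K, ∀ x : Q, p • x = 0) :
    Module.length (MvPolynomial σ K) Q = Module.length K Q := by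
  let : Algebra (MvPolynomial σ K) K := (constantCoeff (R := K) (σ := σ)).toAlgebra
  have hs : ∀ (p : MvPolynomial σ K) (x : Q), p • x = constantCoeff p • x := by
    intro p x
    have := h _ (sub_C_constantCoeff_mem p) x
    rw [sub_smul, sub_eq_zero] at this
    rw [this, ← algebraMap_eq, algebraMap_smul]
  have : IsScalarTower (MvPolynomial σ K) K Q := ⟨fun p c x => by
    rw [hs p (c • x), ← mul_smul]
    rfl⟩
  exact Module.length_eq_of_surjective (S := MvPolynomial σ K) (R := K)
    fun c => ⟨C c, constantCoeff_C σ c⟩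

/-- Induction through `0 → IQ → Q → Q/IQ → 0`, with `I` the ideal of the variables: `I` kills the
quotient, a smaller power of `I` kills `IQ`, and both lengths are additive. -/
theorem length_eq_length_of_pow_smul_eq_zero (n : ℕ) : ∀ (Q : Type u) [AddCommGroup Q]
    [Module (MvPolynomial σ K) Q] [Module K Q] [IsScalarTower K (MvPolynomial σ K) Q],
    (∀ p ∈ idealOfVars σ K ^ n, ∀ x : Q, p • x = 0) →
    Module.length (MvPolynomial σ K) Q = Module.length K Q := by
  induction n with
  | zero =>
    intro Q _ _ _ _ h
    have : Subsingleton Q := ⟨fun x y => by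
      have h1 := fun x => h 1 (by simp) x
      simp only [one_smul] at h1
      rw [h1 x, h1 y]⟩
    rw [Module.length_eq_zero, Module.length_eq_zero]
  | succ n ih =>
    intro Q _ _ _ _ h
    let Q' : Submodule (MvPolynomial σ K) Q := idealOfVars σ K • ⊤
    have h1 : Module.length (MvPolynomial σ K) Q' = Module.length K Q' := by
      refine ih Q' fun p hp x => Subtype.ext ?_
      obtain ⟨x, hx⟩ := x
      change p • x = 0
      induction hx using Submodule.smul_induction_on' with
      | smul r hr y _ =>
        rw [← mul_smul]
        exact h _ (by rw [pow_succ]; exact Ideal.mul_mem_mul hp hr) y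
      | add x _ y _ hx hy => rw [smul_add, hx, hy, add_zero]
    have h2 : Module.length (MvPolynomial σ K) (Q ⧸ Q') = Module.length K (Q ⧸ Q') := by
      refine length_eq_length_of_idealOfVars_smul_eq_zero fun p hp x => ?_
      obtain ⟨x, rfl⟩ := Q'.mkQ_surjective x
      rw [← map_smul]
      exact (Submodule.Quotient.mk_eq_zero _).2 (Submodule.smul_mem_smul hp trivial)
    rw [Module.length_eq_add_of_exact Q'.subtype Q'.mkQ Q'.subtype_injective Q'.mkQ_surjective
      (LinearMap.exact_subtype_mkQ Q'),
      Module.length_eq_add_of_exact (Q'.subtype.restrictScalars K) (Q'.mkQ.restrictScalars K)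
      Q'.subtype_injective Q'.mkQ_surjective (LinearMap.exact_subtype_mkQ Q'), h1, h2]

end Length

/-! ### Numerical identities -/

theorem sum_range_succ_mul_tsub (N : ℕ) :
    ∑ k ∈ Finset.range N, (k + 1) * (N - k) = (N + 2).choose 3 := by
  induction N with
  | zero => rfl
  | succ N ih =>
    -- Raising `N` by one adds `k + 1` to each term; these add up to `C(N+2, 2)`, and Pascal's rule
    -- closes the induction.
    have e : ∀ k ∈ Finset.range (N + 1), (k + 1) * (N + 1 - k) = (k + 1) * (N - k) + (k + 1) := by
      intro k hk
      rw [Finset.mem_range] at hk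
      rw [show N + 1 - k = (N - k) + 1 by omega, mul_add, mul_one]
    rw [Finset.sum_congr rfl e, Finset.sum_add_distrib, Finset.sum_range_succ, ih, Nat.sub_self,
      mul_zero, add_zero, Nat.choose_succ_succ' (N + 2) 2, add_comm]
    congr 1
    have := Finset.sum_range_succ' (fun k => k) (N + 1)
    rw [add_zero] at this
    rw [← this, Finset.sum_range_id, Nat.choose_two_right]

theorem sum_range_succ_mul_pow {F : Type*} [CommRing F] (t : F) (N : ℕ) :
    (∑ k ∈ Finset.range N, ((k + 1 : ℕ) : F) * t ^ k) * (1 - t) ^ 2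
      = 1 - (N + 1) * t ^ N + N * t ^ (N + 1) := by
  induction N with
  | zero => simp
  | succ N ih =>
    rw [Finset.sum_range_succ, add_mul, ih]
    push_cast
    ring

theorem sum_range_succ_mul_tsub_mul_pow {F : Type*} [CommRing F] (t : F) (N : ℕ) :
    (∑ k ∈ Finset.range N, (((k + 1) * (N - k) : ℕ) : F) * t ^ k) * (1 - t) ^ 3
      = N - (N + 2) * t + (N + 2) * t ^ (N + 1) - N * t ^ (N + 2) := by
  induction N with
  | zero => simp
  | succ N ih =>
    have e : ∀ k ∈ Finset.range (N + 1), (((k + 1) * (N + 1 - k) : ℕ) : F) * t ^ k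
        = (((k + 1) * (N - k) : ℕ) : F) * t ^ k + ((k + 1 : ℕ) : F) * t ^ k := by
      intro k hk
      rw [Finset.mem_range] at hk
      rw [show N + 1 - k = (N - k) + 1 by omega]
      push_cast
      ring
    have h := sum_range_succ_mul_pow t (N + 1)
    rw [Finset.sum_congr rfl e, Finset.sum_add_distrib, Finset.sum_range_succ, Nat.sub_self,
      mul_zero, Nat.cast_zero, zero_mul, add_zero, add_mul, ih,
      show (1 - t) ^ 3 = (1 - t) ^ 2 * (1 - t) by ring, ← mul_assoc, h]
    push_cast
    ring

theorem hilbertSeries_eq (N : ℕ) :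
    ∑ k ∈ Finset.range N, HahnSeries.single ((k : ℤ) - 1) (((k + 1) * (N - k) : ℕ) : ℚ)
      = ((((N + 3 : ℕ) : LaurentSeries ℚ) - 3) * tVar⁻¹ + (1 - ((N + 3 : ℕ) : LaurentSeries ℚ))
          + (((N + 3 : ℕ) : LaurentSeries ℚ) - 1) * tVar ^ (N + 3 - 3)
          + (3 - ((N + 3 : ℕ) : LaurentSeries ℚ)) * tVar ^ (N + 3 - 2)) / (1 - tVar) ^ 3 := by
  have ht : tVar ≠ 0 := by simp [tVar]
  have ht1 : 1 - tVar ≠ 0 := by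
    intro h
    have := congrArg (fun s : LaurentSeries ℚ => s.coeff 0) h
    simp [tVar] at this
  have e : ∀ k : ℕ, ∀ c : ℕ, (HahnSeries.single ((k : ℤ) - 1) (c : ℚ) : LaurentSeries ℚ)
      = tVar⁻¹ * ((c : LaurentSeries ℚ) * tVar ^ k) := by
    intro k c
    rw [eq_inv_mul_iff_mul_eq₀ ht, tVar, HahnSeries.single_pow, HahnSeries.single_mul_single,
      ← map_natCast (HahnSeries.C (Γ := ℤ) (R := ℚ)) c, HahnSeries.C_apply,
      HahnSeries.single_mul_single]
    simp
  simp only [e]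
  rw [← Finset.mul_sum, eq_div_iff (pow_ne_zero 3 ht1), mul_assoc, sum_range_succ_mul_tsub_mul_pow,
    show N + 3 - 3 = N by omega, show N + 3 - 2 = N + 1 by omega]
  push_cast
  field_simp
  ring

end

section

variable {K : Type u} [Field K] {N : ℕ} {α : Fin (N + 3) → Fin 3 → K}
  {B : Fin N → Fin (N + 3) → K}

/-! ### The grading of `Ext¹(Ω¹₀, S)` -/

/-- The degree `d` part of `Ext¹(Ω¹₀, S)`. -/
abbrev extPiece (α : Fin (N + 3) → Fin 3 → K) (d : ℤ) :
    Submodule K (ExtOne (ℓ := 3) (K := K) (arrForms α)) :=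
  extOnePiece (ℓ := 3) (arrFormsPiece α) d

namespace IsRelationBasis

theorem mem_extPiece_iff (hB : IsRelationBasis α B) (h : TripleIndep α)
    {d : ℤ} {x : ExtOne (ℓ := 3) (K := K) (arrForms α)} :
    x ∈ extPiece α d ↔ ∃ y ∈ vecPiece K N (d + 1), hB.toExt h (by omega) y = x := by
  rw [extPiece, hB.mem_extOnePiece_iff h (by omega)]
  simp only [mem_vecPiece]

theorem toExt_mem (hB : IsRelationBasis α B) (h : TripleIndep α)
    {d : ℤ} {y : Fin N → Coord K 3} (hy : y ∈ vecPiece K N (d + 1)) :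
    hB.toExt h (by omega) y ∈ extPiece α d :=
  (hB.mem_extPiece_iff h).2 ⟨y, hy, rfl⟩

theorem single_monomial_mem (hB : IsRelationBasis α B) (h : TripleIndep α)
    {r : Fin N} {m : Fin 3 →₀ ℕ} {c : K} :
    hB.toExt h (by omega) (Pi.single r (monomial m c)) ∈ extPiece α (m.degree - 1) := by
  refine hB.toExt_mem h (mem_vecPiece.2 fun r' => ?_)
  rw [sub_add_cancel, Pi.single_apply]
  split_ifs
  · rw [mem_polyPiece_natCast]
    exact isHomogeneous_monomial c rfl
  · exact Submodule.zero_mem _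

theorem toExt_mem_of_le (hB : IsRelationBasis α B) (h : TripleIndep α)
    {V : Submodule K (ExtOne (ℓ := 3) (K := K) (arrForms α))}
    {y : Fin N → Coord K 3}
    (hV : ∀ r, ∀ m ∈ (y r).support, extPiece α ((m.degree : ℤ) - 1) ≤ V) :
    hB.toExt h (by omega) y ∈ V := by
  rw [← Finset.univ_sum_single y, map_sum]
  refine Submodule.sum_mem _ fun r _ => ?_
  have e : (Pi.single r (y r) : Fin N → Coord K 3)
      = ∑ m ∈ (y r).support, Pi.single r (monomial m (coeff m (y r))) := by
    conv_lhs => rw [(y r).as_sum]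
    exact map_sum (LinearMap.single (Coord K 3) (fun _ : Fin N => Coord K 3) r) _ _
  rw [e, map_sum]
  exact Submodule.sum_mem _ fun m hm => hV r m hm (hB.single_monomial_mem h)

theorem iSup_extPiece (hB : IsRelationBasis α B) (h : TripleIndep α) : ⨆ d, extPiece α d = ⊤ := by
  refine eq_top_iff.2 fun x _ => ?_
  obtain ⟨y, rfl⟩ := hB.toExt_surjective h (by omega) x
  exact hB.toExt_mem_of_le h fun r m _ => le_iSup (extPiece α) _

theorem exists_corelationMap_eq (hB : IsRelationBasis α B) (h : TripleIndep α)
    {k : ℤ} {y : Fin N → Coord K 3} (hy : y ∈ vecPiece K N k)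
    (h0 : hB.toExt h (by omega) y = 0) :
    ∃ q ∈ vecPiece K (N + 2) (k - 1), corelationMap α B q = y := by
  obtain ⟨q, rfl⟩ := (hB.toExt_eq_zero_iff h (by omega) y).1 h0
  refine ⟨fun i => polyComp (k - 1) (q i), mem_vecPiece.2 fun i => polyComp_mem _ _,
    funext fun r => ?_⟩
  rw [← polyComp_corelationMap, polyComp_of_mem (mem_vecPiece.1 hy r)]

/-- The transpose is homogeneous of degree 1, so each component of a vector in its image lies in the
image. -/
theorem iSupIndep_extPiece (hB : IsRelationBasis α B) (h : TripleIndep α)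
    : iSupIndep (extPiece α) := by
  rw [iSupIndep_iff_finsetSum_eq_zero_imp_eq_zero]
  intro s v hv hs d hd
  have hv' : ∀ d, ∃ y, d ∈ s → y ∈ vecPiece K N (d + 1) ∧ hB.toExt h (by omega) y = v d := by
    intro d
    by_cases hds : d ∈ s
    · obtain ⟨y, hy⟩ := (hB.mem_extPiece_iff h).1 (hv d hds)
      exact ⟨y, fun _ => hy⟩
    · exact ⟨0, fun h => (hds h).elim⟩
  choose y hy using hv'
  have h0 : hB.toExt h (by omega) (∑ d ∈ s, y d) = 0 := by
    rw [map_sum, ← hs]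
    exact Finset.sum_congr rfl fun d hd => (hy d hd).2
  obtain ⟨q, hq⟩ := (hB.toExt_eq_zero_iff h (by omega) _).1 h0
  rw [← (hy d hd).2, toExt_eq_zero_iff]
  refine ⟨fun i => polyComp (d + 1 - 1) (q i), funext fun r => ?_⟩
  rw [← polyComp_corelationMap, hq, Finset.sum_apply, map_sum, Finset.sum_eq_single d,
    polyComp_of_mem (mem_vecPiece.1 (hy d hd).1 r)]
  · intro e he hed
    exact polyComp_of_mem_of_ne (mem_vecPiece.1 (hy e he).1 r) (by omega)
  · exact fun hd' => (hd' hd).elim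

theorem isModuleGrading (hB : IsRelationBasis α B) (h : TripleIndep α)
    : IsModuleGrading (K := K) (ℓ := 3) (extPiece α) where
  isInternal := DirectSum.isInternal_submodule_of_iSupIndep_of_iSup_eq_top
    (hB.iSupIndep_extPiece h) (hB.iSup_extPiece h)
  smul_mem i d p x hp hx := by
    obtain ⟨y, hy, rfl⟩ := (hB.mem_extPiece_iff h).1 hx
    rw [← map_smul]
    exact hB.toExt_mem h (mem_vecPiece.2 fun r =>
      mul_mem_polyPiece (by ring) hp (mem_vecPiece.1 hy r))

theorem extPiece_of_lt (hB : IsRelationBasis α B) (h : TripleIndep α)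
    {d : ℤ} (hd : d + 1 < 0) : extPiece α d = ⊥ := by
  refine (Submodule.eq_bot_iff _).2 fun x hx => ?_
  obtain ⟨y, hy, rfl⟩ := (hB.mem_extPiece_iff h).1 hx
  have : y = 0 := funext fun r => by
    have := mem_vecPiece.1 hy r
    rwa [polyPiece_of_neg hd, Submodule.mem_bot] at this
  rw [this, map_zero]

/-- The map from vectors of homogeneous polynomials onto a graded piece. -/
def pieceMap (hB : IsRelationBasis α B) (h : TripleIndep α)
    (d : ℤ) : vecPiece K N (d + 1) →ₗ[K] extPiece α d :=
  ((hB.toExt h (by omega)).restrictScalars K).restrict fun _ hy => hB.toExt_mem h hy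

theorem pieceMap_surjective (hB : IsRelationBasis α B) (h : TripleIndep α)
    (d : ℤ) : Function.Surjective (hB.pieceMap h d) := by
  rintro ⟨x, hx⟩
  obtain ⟨y, hy, rfl⟩ := (hB.mem_extPiece_iff h).1 hx
  exact ⟨⟨y, hy⟩, rfl⟩

theorem finiteDimensional_extPiece (hB : IsRelationBasis α B) (h : TripleIndep α)
    (d : ℤ) : FiniteDimensional K (extPiece α d) :=
  Module.Finite.of_surjective _ (hB.pieceMap_surjective h d)

/-- The homogeneous part of `corelationMap`. -/
def corelationPiece (α : Fin (N + 3) → Fin 3 → K) (B : Fin N → Fin (N + 3) → K) (d : ℤ) :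
    vecPiece K (N + 2) d →ₗ[K] vecPiece K N (d + 1) :=
  ((corelationMap α B).restrictScalars K).restrict fun _ hq =>
    mem_vecPiece.2 (corelationMap_mem (by simpa using mem_vecPiece.1 hq))

/-- Rank–nullity for `S_d^(N+2) → S_(d+1)^N → Ext¹_d → 0`, whose first map is injective for `d < N`.
-/
theorem finrank_extPiece_add (hB : IsRelationBasis α B) (h : TripleIndep α) {d : ℤ} (hd : d < N) :
    Module.finrank K (extPiece α d) +
        (N + 2) * Module.finrank K (polyPiece (K := K) (ℓ := 3) d)
      = N * Module.finrank K (polyPiece (K := K) (ℓ := 3) (d + 1)) := by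
  have hinj : Function.Injective (corelationPiece α B d) := by
    rw [← LinearMap.ker_eq_bot, LinearMap.ker_eq_bot']
    intro q hq
    exact Subtype.ext (hB.corelationMap_eq_zero h hd (mem_vecPiece.1 q.2) (congrArg Subtype.val hq))
  have hker : LinearMap.ker (hB.pieceMap h d) = LinearMap.range (corelationPiece α B d) := by
    ext y
    rw [LinearMap.mem_ker, LinearMap.mem_range]
    constructor
    · intro hy
      obtain ⟨q, hq, hqy⟩ := hB.exists_corelationMap_eq h y.2 (congrArg Subtype.val hy)
      exact ⟨⟨q, by simpa using hq⟩, Subtype.ext hqy⟩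
    · rintro ⟨q, rfl⟩
      exact Subtype.ext ((hB.toExt_eq_zero_iff h (by omega) _).2 ⟨q, rfl⟩)
  have h1 := LinearMap.finrank_range_add_finrank_ker (hB.pieceMap h d)
  rw [LinearMap.range_eq_top.2 (hB.pieceMap_surjective h d), finrank_top, hker,
    LinearMap.finrank_range_of_inj hinj, finrank_vecPiece, finrank_vecPiece] at h1
  exact h1

theorem finrank_extPiece (hB : IsRelationBasis α B) (h : TripleIndep α) {k : ℕ} (hk : k ≤ N) :
    Module.finrank K (extPiece α ((k : ℤ) - 1)) = (k + 1) * (N - k) := by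
  have h1 := hB.finrank_extPiece_add h (d := (k : ℤ) - 1) (by omega)
  rw [sub_add_cancel, finrank_polyPiece] at h1
  obtain ⟨j, rfl⟩ := Nat.exists_eq_add_of_le hk
  rw [Nat.add_sub_cancel_left]
  rcases k with _ | k
  -- For `k = 0` the source of the transpose is the zero piece of degree `-1`, which the binomial
  -- formula does not cover.
  · rw [polyPiece_of_neg (by simp), finrank_bot] at h1
    simpa using h1
  · rw [show ((k + 1 : ℕ) : ℤ) - 1 = (k : ℕ) by push_cast; ring, finrank_polyPiece] at h1
    have h2 : ∀ m : ℕ, 2 * (m + 2).choose 2 = (m + 2) * (m + 1) := fun m => by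
      rw [Nat.choose_two_right, Nat.mul_div_cancel' (Nat.even_mul_pred_self _).two_dvd]
      rfl
    rw [show ((k + 1 : ℕ) : ℤ) - 1 = (k : ℕ) by push_cast; ring]
    nlinarith [h2 k, h2 (k + 1)]

/-- The dimension formula gives zero at `k = N`. Above that, a vector of positive degree is a
combination of variables times vectors of one degree less, whose classes already vanish. -/
theorem extPiece_of_ge (hB : IsRelationBasis α B) (h : TripleIndep α)
    {k : ℕ} (hk : N ≤ k) : extPiece α ((k : ℤ) - 1) = ⊥ := by
  induction k, hk using Nat.le_induction with
  | base =>
    have := hB.finiteDimensional_extPiece h ((N : ℤ) - 1)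
    rw [← Submodule.finrank_eq_zero (R := K), hB.finrank_extPiece h le_rfl, Nat.sub_self, mul_zero]
  | succ k hk ih =>
    refine (Submodule.eq_bot_iff _).2 fun x hx => ?_
    obtain ⟨y, hy, rfl⟩ := (hB.mem_extPiece_iff h).1 hx
    have hy' : ∀ r, ∃ c : Fin 3 → Coord K 3,
        (∀ i, c i ∈ polyPiece (K := K) (ℓ := 3) k) ∧ ∑ i, c i * X i = y r := by
      intro r
      have hyr := mem_vecPiece.1 hy r
      have hmem : y r ∈ idealOfVars (Fin 3) K := by
        rw [← pow_one (idealOfVars (Fin 3) K), mem_pow_idealOfVars_iff]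
        intro m hm
        have := hyr m (mem_support_iff.1 hm)
        push_cast at this
        omega
      obtain ⟨c, hc⟩ := Ideal.mem_span_range_iff_exists_fun.1 hmem
      refine ⟨fun i => polyComp k (c i), fun i => polyComp_mem _ _, ?_⟩
      rw [← polyComp_of_mem hyr, ← hc, map_sum]
      exact Finset.sum_congr rfl fun i _ =>
        (polyComp_mul (by push_cast; ring) _ (X_mem_polyPiece i)).symm
    choose c hc hcy using hy'
    have e : y = ∑ i, (X i : Coord K 3) • fun r => c r i := by
      funext r
      rw [← hcy, Finset.sum_apply]
      exact Finset.sum_congr rfl fun i _ => mul_comm _ _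
    rw [e, map_sum]
    refine Finset.sum_eq_zero fun i _ => ?_
    have h1 := hB.toExt_mem h (d := (k : ℤ) - 1) (y := fun r => c r i)
      (mem_vecPiece.2 fun r => by rw [sub_add_cancel]; exact hc r i)
    rw [ih, Submodule.mem_bot] at h1
    rw [map_smul, h1, smul_zero]

theorem hasHilbertSeries (hB : IsRelationBasis α B) (h : TripleIndep α)
    : HasHilbertSeries (extPiece α)
    (∑ k ∈ Finset.range N, HahnSeries.single ((k : ℤ) - 1) (((k + 1) * (N - k) : ℕ) : ℚ)) := by
  intro d
  refine ⟨hB.finiteDimensional_extPiece h d, ?_⟩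
  rw [HahnSeries.coeff_sum]
  simp only [HahnSeries.coeff_single]
  rcases lt_or_ge (d + 1) 0 with hd | hd
  · rw [hB.extPiece_of_lt h hd, finrank_bot, Nat.cast_zero]
    exact Finset.sum_eq_zero fun k _ => if_neg (by omega)
  · obtain ⟨k, hk⟩ := Int.eq_ofNat_of_zero_le hd
    obtain rfl : d = (k : ℤ) - 1 := by omega
    rcases lt_or_ge k N with hkN | hkN
    · rw [hB.finrank_extPiece h hkN.le, Finset.sum_eq_single k, if_pos rfl]
      · exact fun j _ hj => if_neg (by omega)
      · exact fun hk' => (hk' (Finset.mem_range.2 hkN)).elim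
    · rw [hB.extPiece_of_ge h hkN, finrank_bot, Nat.cast_zero]
      refine Finset.sum_eq_zero fun j hj => if_neg ?_
      rw [Finset.mem_range] at hj
      omega

/-- Multiplication by `I^N`, with `I` the ideal of the variables, moves every representative into
polynomial degrees at least `N`, where the class is zero. -/
theorem pow_smul_eq_zero (hB : IsRelationBasis α B) (h : TripleIndep α)
    {p : Coord K 3} (hp : p ∈ idealOfVars (Fin 3) K ^ N)
    (x : ExtOne (ℓ := 3) (K := K) (arrForms α)) : p • x = 0 := by
  obtain ⟨y, rfl⟩ := hB.toExt_surjective h (by omega) x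
  rw [← map_smul, ← Submodule.mem_bot K]
  refine hB.toExt_mem_of_le h fun r m hm => (hB.extPiece_of_ge h ?_).le
  exact (mem_pow_idealOfVars_iff N _).1 (Ideal.mul_mem_right (y r) _ hp) m hm

theorem length_extOne (hB : IsRelationBasis α B) (h : TripleIndep α)
    : Module.length (Coord K 3) (ExtOne (ℓ := 3) (K := K) (arrForms α))
    = ((N + 2).choose 3 : ℕ) := by
  rw [length_eq_length_of_pow_smul_eq_zero N _ fun p hp x => hB.pow_smul_eq_zero h hp x]
  -- Only the degrees `-1, …, N - 2` contribute; indexing them by `Fin N` makes the direct sum a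
  -- finite product.
  let Q : Fin N → Submodule K (ExtOne (ℓ := 3) (K := K) (arrForms α)) :=
    fun k => extPiece α ((k : ℤ) - 1)
  have hint : DirectSum.IsInternal Q := by
    refine DirectSum.isInternal_submodule_of_iSupIndep_of_iSup_eq_top ?_ ?_
    · refine (hB.iSupIndep_extPiece h).comp (f := fun k : Fin N => ((k : ℕ) : ℤ) - 1) ?_
      intro a b hab
      exact Fin.ext (by simpa using hab)
    · refine eq_top_iff.2 ((hB.iSup_extPiece h).ge.trans (iSup_le fun d => ?_))
      rcases lt_or_ge (d + 1) 0 with hd | hd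
      · rw [hB.extPiece_of_lt h hd]
        exact bot_le
      · obtain ⟨k, hk⟩ := Int.eq_ofNat_of_zero_le hd
        obtain rfl : d = (k : ℤ) - 1 := by omega
        rcases lt_or_ge k N with hkN | hkN
        · exact le_iSup Q ⟨k, hkN⟩
        · rw [hB.extPiece_of_ge h hkN]
          exact bot_le
  have e := (LinearEquiv.ofBijective (DirectSum.coeLinearMap Q) hint).symm.trans
    (DirectSum.linearEquivFunOnFintype K (Fin N) fun k => Q k)
  rw [e.length_eq, Module.length_pi_of_fintype, ← sum_range_succ_mul_tsub,
    ← Fin.sum_univ_eq_sum_range (fun k => (k + 1) * (N - k)), Nat.cast_sum]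
  refine Finset.sum_congr rfl fun k _ => ?_
  have := hB.finiteDimensional_extPiece h ((k : ℤ) - 1)
  rw [Module.length_eq_finrank, hB.finrank_extPiece h k.2.le]

end IsRelationBasis

end

end LogForms

end

theorem mainTheorem11 {K : Type*} [Field K] (n : ℕ) (hn : 3 < n) (α : Fin n → Fin 3 → K)
    (hα : LogForms.IsGenericArrangement α) :
    IsArtinian (MvPolynomial (Fin 3) K) (LogForms.ExtOne (K := K) (ℓ := 3) (LogForms.arrForms α)) ∧
    LogForms.IsModuleGrading (K := K) (ℓ := 3)
      (LogForms.extOnePiece (ℓ := 3) (LogForms.arrFormsPiece α)) ∧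
    LogForms.HasHilbertSeries (LogForms.extOnePiece (ℓ := 3) (LogForms.arrFormsPiece α))
      ((((n : LaurentSeries ℚ) - 3) * LogForms.tVar⁻¹ + (1 - (n : LaurentSeries ℚ))
          + ((n : LaurentSeries ℚ) - 1) * LogForms.tVar ^ (n - 3)
          + (3 - (n : LaurentSeries ℚ)) * LogForms.tVar ^ (n - 2)) / (1 - LogForms.tVar) ^ 3) ∧
    Module.length (MvPolynomial (Fin 3) K)
      (LogForms.ExtOne (K := K) (ℓ := 3) (LogForms.arrForms α)) = ((n - 1).choose 3 : ℕ) := by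
  obtain ⟨N, rfl⟩ : ∃ N, n = N + 3 := ⟨n - 3, by omega⟩
  have h := hα.tripleIndep
  obtain ⟨B, hB⟩ := h.exists_isRelationBasis
  have hl := hB.length_extOne h
  refine ⟨?_, hB.isModuleGrading h, LogForms.hilbertSeries_eq N ▸ hB.hasHilbertSeries h, hl⟩
  have hf : IsFiniteLength (MvPolynomial (Fin 3) K)
      (LogForms.ExtOne (K := K) (ℓ := 3) (LogForms.arrForms α)) :=
    Module.length_ne_top_iff.1 (hl ▸ ENat.natCast_ne_top _)
  exact (isFiniteLength_iff_isNoetherian_isArtinian.1 hf).2
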